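/- Let $X_1,X_2,\ldots$ be a real-valued process on a probability space $(\Omega,\mathcal F,P)$. For $n\ge 1$ let $t_n:\mathbb{R}^n\to\mathbb{R}$ be a (measurable) statistic, write $t_n=t_n(X_1,\ldots,X_n)$, let $t(P)\in\mathbb{R}$ be a parameter, let $\tau_n>0$ be scaling factors, and put $T_n=\tau_n(t_n-t(P))$. For $n\ge 2$ let $b=b_n$ be an integer with $1\le b<n$ and put $N_n=n-b+1$, $t_{n,b,i}=t_b(X_i,\ldots,X_{i+b-1})$ and $T_{b,i}=\tau_b(t_{n,b,i}-t(P))$ for $1\le i\le N_n$. Let $$S_n(x)=\frac1{N_n}\sum_{i=1}^{N_n}\mathbf 1\{\tau_b(t_{n,b,i}-t_n)\le x\},\qquad m_n=\frac1{N_n}\sum_{i=1}^{N_n}\tau_b(t_{n,b,i}-t_n),\qquad \hat\sigma_n^2=\frac1{N_n}\sum_{i=1}^{N_n}\bigl(\tau_b(t_{n,b,i}-t_n)-m_n\bigr)^2$$ be the subsampling distribution function, its mean and its variance. For an integer $k\ge1$ let $C_{n,k}$ be the distribution function, given the data, of $k^{-1/2}\sum_{j=1}^{k}(Y^*_j-m_n)$,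 where $Y_1^*,\ldots,Y_k^*$ are i.i.d. with distribution function $S_n$. Let $\Phi$ be the standard normal distribution function and let $\sigma>0$. Suppose that one of the following conditions holds: (C.1) for some probability distribution function $J_0$ with variance $\sigma^2$, $S_n(x)\to J_0(x)$ in probability as $n\to\infty$ for every continuity point $x\in\mathbb{R}$ of $J_0$; (C.2) for some $\epsilon_0>0$, $N_n^{-1}\sum_{i=1}^{N_n}\bigl|\tau_b(t_{n,b,i}-t_n)\bigr|^{2+\epsilon_0}=O_p(1)$; (C.3) the family $\{T_{b,i}^2: 1\le i\le N_n,\ n\ge2\}$ is uniformly integrable, and $T_n=O_p(\tau_n/\tau_b)$; (C.4) $\{X_t\}$ is (strictly) stationary, $\{T_n^2:n\ge1\}$ is uniformly integrable, and $\tau_b/\tau_n=O(1)$. Then the following two statements are equivalent: (a) for every sequence $(k_n)$ of positive integers with $k_n\to\infty$, $\sup_{x\in\mathbb{R}}|C_{n,k_n}(x)-\Phi(x/\sigma)|\to0$ in probability as $n\to\infty$; (b) $\hat\sigma_n^2\to\sigma^2$ in probability as $n\to\infty$. -/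

import Mathlib

open MeasureTheory ProbabilityTheory Filter Topology Asymptotics

noncomputable section

namespace Subsampling

variable {Ω : Type*}

/-- The stretch `(X_i, …, X_{i+m-1})` of length `m` of the process, started at time `i`.
The data are `X_1, X_2, …`; the value `X 0` is never used. -/
def block (X : ℕ → Ω → ℝ) (i m : ℕ) (ω : Ω) : Fin m → ℝ :=
  fun j => X (i + j) ω

/-- `t_m(X_i, …, X_{i+m-1})`. For `i = 1`, `m = n` this is the estimator `t_n` from the full
sample; for `m = b` it is the subsample statistic `t_{n,b,i}`. -/
def stat (t : (m : ℕ) → (Fin m → ℝ) → ℝ) (X : ℕ → Ω → ℝ) (i m : ℕ) (ω : Ω) : ℝ :=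
  t m (block X i m ω)

/-- `T_{m,i} = τ_m (t_m(X_i, …, X_{i+m-1}) - θ)`, where `θ = t(P)` is the parameter.
`T_n` is `scaledError t τ θ X 1 n` and `T_{b,i}` is `scaledError t τ θ X i b`. -/
def scaledError (t : (m : ℕ) → (Fin m → ℝ) → ℝ) (τ : ℕ → ℝ) (θ : ℝ)
    (X : ℕ → Ω → ℝ) (i m : ℕ) (ω : Ω) : ℝ :=
  τ m * (stat t X i m ω - θ)

/-- The number `N_n = n - b + 1` of overlapping blocks of length `b` (used for `b < n`). -/
def numBlocks (n b : ℕ) : ℕ := n - b + 1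

/-- The subsample analog `τ_b (t_{n,b,i} - t_n)` of `T_n`. -/
def analog (t : (m : ℕ) → (Fin m → ℝ) → ℝ) (τ : ℕ → ℝ)
    (X : ℕ → Ω → ℝ) (n b i : ℕ) (ω : Ω) : ℝ :=
  τ b * (stat t X i b ω - stat t X 1 n ω)

/-- The subsampling distribution function
`S_n(x) = N_n⁻¹ ∑_{i=1}^{N_n} 1(τ_b (t_{n,b,i} - t_n) ≤ x)`. -/
def subCDF (t : (m : ℕ) → (Fin m → ℝ) → ℝ) (τ : ℕ → ℝ)
    (X : ℕ → Ω → ℝ) (n b : ℕ) (x : ℝ) (ω : Ω) : ℝ :=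
  (numBlocks n b : ℝ)⁻¹ * ∑ i ∈ Finset.Icc 1 (numBlocks n b),
    (Set.Iic x).indicator (fun _ => (1 : ℝ)) (analog t τ X n b i ω)

/-- The subsampling distribution as a (random) measure on `ℝ`: the empirical measure of the
`N_n` subsample analogs. -/
def subLaw (t : (m : ℕ) → (Fin m → ℝ) → ℝ) (τ : ℕ → ℝ)
    (X : ℕ → Ω → ℝ) (n b : ℕ) (ω : Ω) : Measure ℝ :=
  (numBlocks n b : ENNReal)⁻¹ • ∑ i ∈ Finset.Icc 1 (numBlocks n b),
    Measure.dirac (analog t τ X n b i ω)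

/-- The mean of the subsampling distribution. -/
def subMean (t : (m : ℕ) → (Fin m → ℝ) → ℝ) (τ : ℕ → ℝ)
    (X : ℕ → Ω → ℝ) (n b : ℕ) (ω : Ω) : ℝ :=
  (numBlocks n b : ℝ)⁻¹ * ∑ i ∈ Finset.Icc 1 (numBlocks n b), analog t τ X n b i ω

/-- The variance of the subsampling distribution. -/
def subVar (t : (m : ℕ) → (Fin m → ℝ) → ℝ) (τ : ℕ → ℝ)
    (X : ℕ → Ω → ℝ) (n b : ℕ) (ω : Ω) : ℝ :=
  (numBlocks n b : ℝ)⁻¹ * ∑ i ∈ Finset.Icc 1 (numBlocks n b),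
    (analog t τ X n b i ω - subMean t τ X n b ω) ^ 2

/-- The convolved subsampling distribution function `C_{n,k}(x) = P_*(Z* ≤ x)`, where
`Z* = k^{-1/2} ∑_{j=1}^k (Y_j - m)` with `Y_1, …, Y_k` i.i.d. from the subsampling distribution
(so that their joint law is the product measure) and `m` its mean. -/
def convCDF (t : (m : ℕ) → (Fin m → ℝ) → ℝ) (τ : ℕ → ℝ)
    (X : ℕ → Ω → ℝ) (n b k : ℕ) (x : ℝ) (ω : Ω) : ℝ :=
  (Measure.pi (fun _ : Fin k => subLaw t τ X n b ω)).real
    {y | (Real.sqrt k)⁻¹ * ∑ j, (y j - subMean t τ X n b ω) ≤ x}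

/-- The standard normal distribution function `Φ`. -/
def stdNormalCDF (x : ℝ) : ℝ := cdf (gaussianReal 0 1) x

/-- `W_n = O_p(a_n)` as `n → ∞`. -/
def IsBigOInProb [MeasurableSpace Ω] (P : Measure Ω) (W : ℕ → Ω → ℝ) (a : ℕ → ℝ) : Prop :=
  ∀ ε : ENNReal, 0 < ε → ∃ M : ℝ, ∀ᶠ n in atTop, P {ω | M * |a n| < |W n ω|} ≤ ε

/-- (Strict) stationarity of `X_1, X_2, …`: for all times `s_1, …, s_m ≥ 1` and every shift `h`,
`(X_{s_1+h}, …, X_{s_m+h})` has the same law as `(X_{s_1}, …, X_{s_m})`. -/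
def IsStationary [MeasurableSpace Ω] (P : Measure Ω) (X : ℕ → Ω → ℝ) : Prop :=
  ∀ (m : ℕ) (s : Fin m → ℕ), (∀ j, 1 ≤ s j) → ∀ h : ℕ,
    IdentDistrib (fun ω (j : Fin m) => X (s j + h) ω) (fun ω (j : Fin m) => X (s j) ω) P P

/-- The empirical measure is a probability measure. -/
instance subLaw_isProbabilityMeasure (t : (m : ℕ) → (Fin m → ℝ) → ℝ) (τ : ℕ → ℝ)
    (X : ℕ → Ω → ℝ) (n b : ℕ) (ω : Ω) : IsProbabilityMeasure (subLaw t τ X n b ω) := by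
  constructor
  have h : (numBlocks n b : ENNReal) ≠ 0 := by simp [numBlocks]
  simp [subLaw, ENNReal.inv_mul_cancel h (ENNReal.natCast_ne_top _)]

/-- Its distribution function is the subsampling distribution function. -/
theorem subLaw_real_Iic (t : (m : ℕ) → (Fin m → ℝ) → ℝ) (τ : ℕ → ℝ)
    (X : ℕ → Ω → ℝ) (n b : ℕ) (x : ℝ) (ω : Ω) :
    (subLaw t τ X n b ω).real (Set.Iic x) = subCDF t τ X n b x ω := by
  simp only [subLaw, subCDF, Measure.real, Measure.smul_apply, smul_eq_mul, ENNReal.toReal_mul,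
    ENNReal.toReal_inv, ENNReal.toReal_natCast, Measure.finsetSum_apply]
  congr 1
  rw [ENNReal.toReal_sum (fun i _ => measure_ne_top _ _)]
  refine Finset.sum_congr rfl fun i _ => ?_
  by_cases hx : analog t τ X n b i ω ≤ x <;> simp [Set.indicator, hx]

end Subsampling

end

/-! Given the data, the convolved law depends only on the empirical measure of the subsample
analogs, so the equivalence is proved for random probability measures `ν n ω` with finite second
moment and then specialised to `subLaw`.

(b) to (a): if the tails of `ν n` contribute little to its variance beyond some fixed level, with
high probability (`TailsNegligible`), then Lindeberg's condition holds at level `δ * √k` for every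
`k n → ∞`. The triangular-array central limit theorem `tendsto_cdf_sumLaw` is turned into a
quantitative implication uniform over all laws (`exists_abs_cdf_sumLaw_sub_le`), which can be
applied for each `ω` in an event of high probability. It remains to derive negligible tails from
each condition. Moments and uniform integrability give them through Markov-type bounds. Under weak
convergence they come from convergence of the variances: the limit has the same variance, so no
variance escapes to infinity.

(a) to (b): for fixed `n` the ordinary central limit theorem sends the convolved distribution
function at `1`, as `k → ∞`, to that of a centred normal law with variance `subVar`. Choosing `k n`
so large that this error is small in probability, (a) forces the normal distribution functions at
`1` to converge. Their value at `1` is strictly decreasing in the variance, so the variances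
converge. -/

namespace Subsampling

/-! ### Characteristic functions and the central limit theorem for triangular arrays. -/

/-- The law of `k^{-1/2} ∑_{j<k} (Y_j - m)` for `Y_j` i.i.d. with law `μ` of mean `m`. -/
noncomputable def sumLaw (μ : Measure ℝ) (k : ℕ) : Measure ℝ :=
  (Measure.pi (fun _ : Fin k => μ)).map
    (fun y => (Real.sqrt k)⁻¹ * ∑ j, (y j - ∫ x, x ∂μ))

/-- The contribution to the variance of `μ` of the points at distance more than `c` from the
mean. -/
noncomputable def truncVar (μ : Measure ℝ) (c : ℝ) : ℝ :=
  ∫ x, {x | c < |x - ∫ x, x ∂μ|}.indicator (fun x => (x - ∫ x, x ∂μ) ^ 2) x ∂μ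

theorem measurable_normalizedSum (k : ℕ) (m : ℝ) :
    Measurable (fun y : Fin k → ℝ => (Real.sqrt k)⁻¹ * ∑ j, (y j - m)) := by
  fun_prop

instance isProbabilityMeasure_sumLaw (μ : Measure ℝ) [IsProbabilityMeasure μ] (k : ℕ) :
    IsProbabilityMeasure (sumLaw μ k) :=
  Measure.isProbabilityMeasure_map (measurable_normalizedSum k _).aemeasurable

theorem charFun_sumLaw (μ : Measure ℝ) [IsProbabilityMeasure μ] (k : ℕ) (s : ℝ) :
    charFun (sumLaw μ k) s
      = (charFun (μ.map (fun x => x - ∫ x, x ∂μ)) ((Real.sqrt k)⁻¹ * s)) ^ k := by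
  have hpi : (Measure.pi (fun _ : Fin k => μ)).map (fun y j => y j - ∫ x, x ∂μ)
      = Measure.pi (fun _ : Fin k => μ.map (fun x => x - ∫ x, x ∂μ)) := by
    have : IsProbabilityMeasure (μ.map (fun x => x - ∫ x, x ∂μ)) :=
      Measure.isProbabilityMeasure_map (by fun_prop)
    exact Measure.pi_map_pi (f := fun _ x => x - ∫ x, x ∂μ) (fun _ => by fun_prop)
  have : IsProbabilityMeasure (μ.map (fun x => x - ∫ x, x ∂μ)) :=
    Measure.isProbabilityMeasure_map (by fun_prop)
  have hmap : sumLaw μ k = (Measure.pi (fun _ : Fin k => μ.map (fun x => x - ∫ x, x ∂μ))).map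
      (fun y => (Real.sqrt k)⁻¹ * ∑ j, y j) := by
    rw [← hpi, Measure.map_map (by fun_prop) (by fun_prop)]
    rfl
  rw [hmap, charFun_map_mul_comp (by fun_prop)]
  have := charFun_map_sum_pi_eq_prod (μ := fun _ : Fin k => μ.map (fun x => x - ∫ x, x ∂μ))
  have h2 := congrFun this ((Real.sqrt k)⁻¹ * s)
  simpa using h2

/-- The cubic bound serves small `u` and the quadratic one large `u`; this is the usual split in
Lindeberg's argument. For `|u| ≥ 1` the triangle inequality gives `2 + |u| + u ^ 2 / 2`, which the
constant `4` absorbs. -/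
theorem norm_exp_sub_taylor_two_le (u : ℝ) :
    ‖Complex.exp (u * Complex.I) - (1 + u * Complex.I - u ^ 2 / 2)‖ ≤ 4 * |u| ^ 3 ∧
    ‖Complex.exp (u * Complex.I) - (1 + u * Complex.I - u ^ 2 / 2)‖ ≤ 4 * u ^ 2 := by
  have hu0 := abs_nonneg u
  have hsq : u ^ 2 = |u| ^ 2 := (sq_abs u).symm
  rcases le_total |u| 1 with h | h
  · have hb := Complex.exp_bound (x := u * Complex.I) (by simpa using h) (n := 3) (by norm_num)
    have e : ∑ m ∈ Finset.range 3, ((u : ℂ) * Complex.I) ^ m / (m.factorial : ℂ)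
        = 1 + u * Complex.I - u ^ 2 / 2 := by
      simp [Finset.sum_range_succ, mul_pow, Complex.I_sq]
      ring
    rw [e] at hb
    have hb' : ‖Complex.exp (u * Complex.I) - (1 + u * Complex.I - u ^ 2 / 2)‖ ≤ |u| ^ 3 := by
      refine hb.trans ?_
      have : ‖(u : ℂ) * Complex.I‖ = |u| := by simp
      rw [this]
      refine mul_le_of_le_one_right (by positivity) ?_
      norm_num [Nat.factorial]
    have h3 : |u| ^ 3 ≤ |u| ^ 2 := pow_le_pow_of_le_one hu0 h (by norm_num)
    have h4 : 0 ≤ |u| ^ 3 := by positivity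
    constructor
    · linarith
    · rw [hsq]; nlinarith
  · have hb : ‖Complex.exp (u * Complex.I) - (1 + u * Complex.I - u ^ 2 / 2)‖
        ≤ 1 + (1 + |u| + |u| ^ 2 / 2) := by
      refine (norm_sub_le _ _).trans ?_
      rw [Complex.norm_exp_ofReal_mul_I]
      gcongr
      refine (norm_sub_le _ _).trans ?_
      refine add_le_add ((norm_add_le _ _).trans ?_) ?_
      · simp
      · simp
    have h3 : |u| ^ 2 ≤ |u| ^ 3 := pow_le_pow_right₀ h (by norm_num)
    have h4 : |u| ≤ |u| ^ 2 := by nlinarith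
    constructor
    · linarith
    · rw [hsq]; nlinarith

theorem integrable_sub_sq {μ : Measure ℝ} [IsProbabilityMeasure μ] (hμ : MemLp id 2 μ) (a : ℝ) :
    Integrable (fun x => (x - a) ^ 2) μ :=
  (hμ.sub (memLp_const a)).integrable_sq

theorem integrable_id_of_memLp_two {μ : Measure ℝ} [IsProbabilityMeasure μ]
    (hμ : MemLp id 2 μ) : Integrable (fun x => x) μ :=
  hμ.integrable (by norm_num)

theorem variance_id_eq {μ : Measure ℝ} [IsProbabilityMeasure μ] :
    variance id μ = ∫ x, (x - ∫ x, x ∂μ) ^ 2 ∂μ := by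
  rw [variance_eq_integral aemeasurable_id]
  rfl

theorem integrable_truncated_sq {μ : Measure ℝ} [IsProbabilityMeasure μ] (hμ : MemLp id 2 μ)
    (c : ℝ) : Integrable (fun x => {x | c < |x - ∫ x, x ∂μ|}.indicator
      (fun x => (x - ∫ x, x ∂μ) ^ 2) x) μ :=
  (integrable_sub_sq hμ _).indicator (measurableSet_lt (by fun_prop) (by fun_prop))

theorem truncVar_nonneg (μ : Measure ℝ) (c : ℝ) : 0 ≤ truncVar μ c :=
  integral_nonneg fun x => Set.indicator_nonneg (fun _ _ => sq_nonneg _) x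

theorem truncVar_anti {μ : Measure ℝ} [IsProbabilityMeasure μ] (hμ : MemLp id 2 μ)
    {c d : ℝ} (h : c ≤ d) : truncVar μ d ≤ truncVar μ c := by
  refine integral_mono (integrable_truncated_sq hμ d) (integrable_truncated_sq hμ c) fun x => ?_
  exact Set.indicator_le_indicator_of_subset (fun x (hx : d < _) => h.trans_lt hx)
    (fun _ => sq_nonneg _) x

/-- Integrate the Taylor remainder, using the cubic bound within distance `c` of the mean, where `|x
- m| ^ 3 ≤ c * (x - m) ^ 2`, and the quadratic bound beyond it. -/
theorem norm_charFun_centered_sub_le {μ : Measure ℝ} [IsProbabilityMeasure μ]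
    (hμ : MemLp id 2 μ) (s : ℝ) {c : ℝ} (hc : 0 ≤ c) :
    ‖charFun (μ.map (fun x => x - ∫ x, x ∂μ)) s - (1 - (variance id μ) * s ^ 2 / 2 : ℝ)‖
      ≤ 4 * (|s| ^ 3 * c * variance id μ + s ^ 2 * truncVar μ c) := by
  set m := ∫ x, x ∂μ with hm
  have hi1 := integrable_id_of_memLp_two hμ
  have hi2 := integrable_sub_sq hμ m
  have hi1' : Integrable (fun x => x - m) μ := hi1.sub (integrable_const m)
  have h0 : ∫ x, (x - m) ∂μ = 0 := by
    rw [integral_sub hi1 (integrable_const m)]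
    simp [hm]
  have hexp : Integrable (fun x : ℝ => Complex.exp ((s * (x - m) : ℝ) * Complex.I)) μ := by
    refine (integrable_const (1 : ℝ)).mono' (by fun_prop) (ae_of_all _ fun x => ?_)
    rw [Complex.norm_exp_ofReal_mul_I]
  have e1 : Integrable (fun x : ℝ => ((s * (x - m) : ℝ) : ℂ) * Complex.I) μ :=
    ((hi1'.const_mul s).ofReal (𝕜 := ℂ)).mul_const Complex.I
  have e2 : Integrable (fun x : ℝ => ((s ^ 2 * (x - m) ^ 2 : ℝ) : ℂ) / 2) μ :=
    ((hi2.const_mul (s ^ 2)).ofReal (𝕜 := ℂ)).div_const 2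
  have hpoly : Integrable (fun x : ℝ => (1 + (s * (x - m) : ℝ) * Complex.I
      - ((s * (x - m) : ℝ) : ℂ) ^ 2 / 2 : ℂ)) μ := by
    refine (((integrable_const (1 : ℂ)).add e1).sub e2).congr (ae_of_all _ fun x => ?_)
    simp [mul_pow]
  have hcf : charFun (μ.map (fun x => x - m)) s
      = ∫ x, Complex.exp ((s * (x - m) : ℝ) * Complex.I) ∂μ := by
    rw [charFun_apply_real, integral_map (by fun_prop) (by fun_prop)]
    simp
  have hpv : ∫ x, (1 + (s * (x - m) : ℝ) * Complex.I
      - ((s * (x - m) : ℝ) : ℂ) ^ 2 / 2 : ℂ) ∂μ = (1 - (variance id μ) * s ^ 2 / 2 : ℝ) := by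
    have : ∀ x : ℝ, (1 + (s * (x - m) : ℝ) * Complex.I
        - ((s * (x - m) : ℝ) : ℂ) ^ 2 / 2 : ℂ)
        = (1 + ((s * (x - m) : ℝ) : ℂ) * Complex.I) - ((s ^ 2 * (x - m) ^ 2 : ℝ) : ℂ) / 2 := by
      intro x; push_cast; ring
    simp_rw [this]
    have i3 : Integrable (fun x : ℝ => (1 : ℂ) + ((s * (x - m) : ℝ) : ℂ) * Complex.I) μ :=
      (integrable_const (1 : ℂ)).add e1
    rw [integral_sub i3 e2, integral_add (integrable_const _) e1]
    rw [integral_mul_const, integral_div, integral_complex_ofReal, integral_complex_ofReal,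
      integral_const_mul, integral_const_mul, h0, variance_id_eq]
    simp
    ring
  have hi3 := integrable_truncated_sq hμ c
  rw [hcf, ← hpv, ← integral_sub hexp hpoly]
  have hbd : Integrable (fun x => 4 * (|s| ^ 3 * c * (x - m) ^ 2 + s ^ 2 *
      {x | c < |x - ∫ x, x ∂μ|}.indicator (fun x => (x - ∫ x, x ∂μ) ^ 2) x)) μ :=
    ((hi2.const_mul _).add (hi3.const_mul _)).const_mul 4
  refine (norm_integral_le_of_norm_le hbd (ae_of_all _ fun x => ?_)).trans (le_of_eq ?_)
  · obtain ⟨h3, h2⟩ := norm_exp_sub_taylor_two_le (s * (x - m))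
    by_cases hx : c < |x - m|
    · rw [Set.indicator_of_mem (by simpa [← hm] using hx)]
      refine h2.trans ?_
      rw [← hm]
      have : 0 ≤ |s| ^ 3 * c * (x - m) ^ 2 := by positivity
      nlinarith
    · rw [Set.indicator_of_notMem (by simpa [← hm] using hx)]
      refine h3.trans ?_
      rw [abs_mul, mul_pow]
      have : |x - m| ^ 3 ≤ c * (x - m) ^ 2 := by
        rw [← sq_abs (x - m), pow_succ, mul_comm]
        exact mul_le_mul_of_nonneg_right (not_lt.mp hx) (by positivity)
      have h5 : |s| ^ 3 * |x - m| ^ 3 ≤ |s| ^ 3 * (c * (x - m) ^ 2) := by gcongr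
      linarith
  · rw [integral_const_mul, integral_add (hi2.const_mul _) (hi3.const_mul _),
      integral_const_mul, integral_const_mul, variance_id_eq]
    rfl

theorem norm_pow_sub_pow_le_mul {z w : ℂ} (hz : ‖z‖ ≤ 1) (hw : ‖w‖ ≤ 1) (k : ℕ) :
    ‖z ^ k - w ^ k‖ ≤ k * ‖z - w‖ := by
  induction k with
  | zero => simp
  | succ k ih =>
    have e : z ^ (k + 1) - w ^ (k + 1) = z ^ k * (z - w) + (z ^ k - w ^ k) * w := by ring
    rw [e]
    refine (norm_add_le _ _).trans ?_
    rw [norm_mul, norm_mul, norm_pow]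
    have h1 : ‖z‖ ^ k ≤ 1 := pow_le_one₀ (norm_nonneg _) hz
    have h2 : ‖z‖ ^ k * ‖z - w‖ ≤ 1 * ‖z - w‖ := by gcongr
    have h3 : ‖z ^ k - w ^ k‖ * ‖w‖ ≤ (k * ‖z - w‖) * 1 := by gcongr
    push_cast
    linarith

/-- Both sides are `k`-th powers of numbers in the unit disc, so the error is at most `k` times the
error of one factor. The last term is the cost of replacing `1 - x` by `exp (-x)`. -/
theorem norm_charFun_sumLaw_sub_le {μ : Measure ℝ} [IsProbabilityMeasure μ]
    (hμ : MemLp id 2 μ) (s : ℝ) {δ : ℝ} (hδ : 0 ≤ δ) {k : ℕ} (hk : 0 < k)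
    (hsk : variance id μ * s ^ 2 / 2 ≤ k) :
    ‖charFun (sumLaw μ k) s - Real.exp (-(variance id μ * s ^ 2 / 2))‖
      ≤ 4 * (|s| ^ 3 * δ * variance id μ + s ^ 2 * truncVar μ (δ * Real.sqrt k))
        + (variance id μ * s ^ 2 / 2) ^ 2 / k := by
  set v := variance id μ with hv
  have hv0 : 0 ≤ v := variance_nonneg _ _
  have hk' : (0 : ℝ) < k := by exact_mod_cast hk
  have hr : 0 < Real.sqrt k := Real.sqrt_pos.mpr hk'
  have hrr : Real.sqrt k * Real.sqrt k = k := Real.mul_self_sqrt hk'.le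
  set r := Real.sqrt k with hrdef
  set x := v * s ^ 2 / 2 / k with hx
  have hx0 : 0 ≤ x := by positivity
  have hx1 : x ≤ 1 := by rw [hx, div_le_one hk']; exact hsk
  -- At the level `δ * √k` the cubic term scales as `k * k ^ (-3/2) * δ * √k = δ`.
  have hb := norm_charFun_centered_sub_le hμ (r⁻¹ * s) (c := δ * r) (by positivity)
  have hprob : IsProbabilityMeasure (μ.map (fun x => x - ∫ x, x ∂μ)) :=
    Measure.isProbabilityMeasure_map (by fun_prop)
  rw [charFun_sumLaw]
  have hexp : ((Real.exp (-(v * s ^ 2 / 2)) : ℝ) : ℂ) = ((Real.exp (-x) : ℝ) : ℂ) ^ k := by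
    rw [← Complex.ofReal_pow, ← Real.exp_nat_mul]
    congr 2
    rw [hx]; field_simp
  rw [hexp]
  have hxe : v * (r⁻¹ * s) ^ 2 / 2 = x := by
    rw [hx, ← hrr]; field_simp
  rw [← hv, hxe] at hb
  have hexp1 : ‖((Real.exp (-x) : ℝ) : ℂ)‖ ≤ 1 := by
    rw [Complex.norm_real, Real.norm_eq_abs, abs_of_pos (Real.exp_pos _)]
    exact Real.exp_le_one_iff.mpr (by linarith)
  refine (norm_pow_sub_pow_le_mul (norm_charFun_le_one _) hexp1 k).trans ?_
  have h2 : ‖((1 - x : ℝ) : ℂ) - ((Real.exp (-x) : ℝ) : ℂ)‖ ≤ x ^ 2 := by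
    rw [← Complex.ofReal_sub, Complex.norm_real, ← norm_neg]
    have := Real.norm_exp_sub_one_sub_id_le (x := -x) (by simpa [abs_of_nonneg hx0] using hx1)
    calc _ = ‖Real.exp (-x) - 1 - -x‖ := by congr 1; ring
      _ ≤ ‖-x‖ ^ 2 := this
      _ = x ^ 2 := by simp
  have h3 := (norm_sub_le_norm_sub_add_norm_sub _ ((1 - x : ℝ) : ℂ) _).trans (add_le_add hb h2)
  refine (mul_le_mul_of_nonneg_left h3 hk'.le).trans (le_of_eq ?_)
  rw [abs_mul, abs_inv, abs_of_pos hr, mul_add]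
  congr 1
  · rw [← hrr]; field_simp
  · rw [hx]; field_simp

theorem tendsto_cdf_of_tendsto {ι : Type*} {l : Filter ι} {μ : ι → ProbabilityMeasure ℝ}
    {ν : ProbabilityMeasure ℝ} (h : Tendsto μ l (𝓝 ν)) {x : ℝ} (hx : (ν : Measure ℝ) {x} = 0) :
    Tendsto (fun i => cdf (μ i : Measure ℝ) x) l (𝓝 (cdf (ν : Measure ℝ) x)) := by
  have := ProbabilityMeasure.tendsto_measure_of_null_frontier_of_tendsto' h (E := Set.Iic x)
    (by rwa [frontier_Iic])
  simp_rw [cdf_eq_real]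
  exact (ENNReal.tendsto_toReal (measure_ne_top _ _)).comp this

/-- Central limit theorem for row-wise i.i.d. triangular arrays under Lindeberg's condition. -/
theorem tendsto_cdf_sumLaw {μ : ℕ → Measure ℝ} [∀ n, IsProbabilityMeasure (μ n)]
    (hμ : ∀ n, MemLp id 2 (μ n)) {k : ℕ → ℕ} (hk : Tendsto k atTop atTop) {v : NNReal}
    (hv : Tendsto (fun n => variance id (μ n)) atTop (𝓝 v))
    (hL : ∀ δ : ℝ, 0 < δ →
      Tendsto (fun n => truncVar (μ n) (δ * Real.sqrt (k n))) atTop (𝓝 0))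
    {x : ℝ} (hx : gaussianReal 0 v {x} = 0) :
    Tendsto (fun n => cdf (sumLaw (μ n) (k n)) x) atTop (𝓝 (cdf (gaussianReal 0 v) x)) := by
  let ν : ℕ → ProbabilityMeasure ℝ := fun n => ⟨sumLaw (μ n) (k n), inferInstance⟩
  let γ : ProbabilityMeasure ℝ := ⟨gaussianReal 0 v, inferInstance⟩
  suffices h : Tendsto ν atTop (𝓝 γ) from tendsto_cdf_of_tendsto h hx
  refine ProbabilityMeasure.tendsto_of_tendsto_charFun fun s => ?_
  simp only [ν, γ, ProbabilityMeasure.coe_mk, charFun_gaussianReal]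
  have hkR : Tendsto (fun n => (k n : ℝ)) atTop atTop := tendsto_natCast_atTop_atTop.comp hk
  have hlim : Tendsto (fun n => ((Real.exp (-(variance id (μ n) * s ^ 2 / 2)) : ℝ) : ℂ)) atTop
      (𝓝 (Complex.exp (s * (0 : ℝ) * Complex.I - v * s ^ 2 / 2))) := by
    have : Complex.exp (s * (0 : ℝ) * Complex.I - v * s ^ 2 / 2)
        = ((Real.exp (-(v * s ^ 2 / 2)) : ℝ) : ℂ) := by push_cast; congr 1; ring
    rw [this]
    refine (Complex.continuous_ofReal.tendsto _).comp ((Real.continuous_exp.tendsto _).comp ?_)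
    exact (hv.mul_const (s ^ 2)).div_const 2 |>.neg
  suffices h : Tendsto (fun n => charFun (sumLaw (μ n) (k n)) s
      - ((Real.exp (-(variance id (μ n) * s ^ 2 / 2)) : ℝ) : ℂ)) atTop (𝓝 0) by
    simpa using h.add hlim
  rw [tendsto_zero_iff_norm_tendsto_zero, Metric.tendsto_nhds]
  intro ε hε
  -- The cubic term is the only one that does not vanish in the limit; it is made small through `δ`.
  obtain ⟨δ, hδ, hδε⟩ : ∃ δ : ℝ, 0 < δ ∧ 4 * (|s| ^ 3 * δ * v) < ε := by
    refine ⟨ε / (4 * (|s| ^ 3 * v) + 1), by positivity, ?_⟩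
    have : 0 < 4 * (|s| ^ 3 * v) + 1 := by positivity
    rw [show 4 * (|s| ^ 3 * (ε / (4 * (|s| ^ 3 * v) + 1)) * v)
      = (4 * (|s| ^ 3 * v) * ε) / (4 * (|s| ^ 3 * v) + 1) by ring, div_lt_iff₀ this]
    nlinarith
  have hbound : Tendsto (fun n => 4 * (|s| ^ 3 * δ * variance id (μ n)
      + s ^ 2 * truncVar (μ n) (δ * Real.sqrt (k n)))
      + (variance id (μ n) * s ^ 2 / 2) ^ 2 / (k n)) atTop
      (𝓝 (4 * (|s| ^ 3 * δ * v + s ^ 2 * 0) + 0)) := by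
    refine Tendsto.add ?_ ?_
    · exact ((hv.const_mul _).add ((hL δ hδ).const_mul _)).const_mul 4
    · exact (((hv.mul_const (s ^ 2)).div_const 2).pow 2).div_atTop hkR
  have h1 := hbound.eventually_lt_const (by simpa using hδε : _ < ε)
  have h2 : ∀ᶠ n in atTop, variance id (μ n) * s ^ 2 / 2 ≤ k n := by
    have a := ((hv.mul_const (s ^ 2)).div_const 2).eventually_lt_const (lt_add_one _)
    filter_upwards [a, hkR.eventually_ge_atTop (v * s ^ 2 / 2 + 1)] with n h1 h2
    linarith
  filter_upwards [h1, h2, hk.eventually_gt_atTop 0] with n h1 h2 h3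
  rw [Real.dist_0_eq_abs, abs_of_nonneg (norm_nonneg _)]
  exact (norm_charFun_sumLaw_sub_le (hμ n) s hδ.le h3 h2).trans_lt h1

/-! ### Uniform convergence of distribution functions. -/

/-- Pólya's theorem: pointwise convergence of distribution functions to a continuous one is
uniform. -/
theorem eventually_abs_cdf_sub_le {ι : Type*} {l : Filter ι} {μ : ι → Measure ℝ} {ν : Measure ℝ}
    (hν : Continuous (cdf ν)) (h : ∀ x, Tendsto (fun i => cdf (μ i) x) l (𝓝 (cdf ν x)))
    {ε : ℝ} (hε : 0 < ε) : ∀ᶠ i in l, ∀ x, |cdf (μ i) x - cdf ν x| ≤ ε := by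
  have hclose : ∀ x, ∀ᶠ i in l, |cdf (μ i) x - cdf ν x| < ε / 2 := fun x => by
    simpa [Real.dist_eq] using (Metric.tendsto_nhds.mp (h x)) (ε / 2) (by positivity)
  obtain ⟨A, hA⟩ := ((tendsto_cdf_atBot ν).eventually_lt_const (half_pos hε)).exists
  obtain ⟨B, hB⟩ := ((tendsto_cdf_atTop ν).eventually_const_lt
    (by linarith : 1 - ε / 2 < 1)).exists
  have hmid : ∀ᶠ i in l, ∀ x ∈ Set.Icc A B, |cdf (μ i) x - cdf ν x| ≤ ε := by
    -- Compactness leaves a local claim: on a short interval monotonicity reduces the estimate to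
    -- the two endpoints.
    refine isCompact_Icc.induction_on (p := fun U => ∀ᶠ i in l, ∀ x ∈ U,
      |cdf (μ i) x - cdf ν x| ≤ ε) (by simp) ?_ ?_ ?_
    · intro s t hst ht
      filter_upwards [ht] with i hi x hx using hi x (hst hx)
    · intro s t hs ht
      filter_upwards [hs, ht] with i h1 h2 x hx using hx.elim (h1 x) (h2 x)
    · intro x _
      have hc := Metric.continuous_iff.mp hν x (ε / 4) (by positivity)
      obtain ⟨d, hd, hd'⟩ := hc
      have ha := hd' (x - d / 2) (by rw [Real.dist_eq, abs_lt]; constructor <;> linarith)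
      have hb := hd' (x + d / 2) (by rw [Real.dist_eq, abs_lt]; constructor <;> linarith)
      rw [Real.dist_eq, abs_lt] at ha hb
      refine ⟨Set.Icc (x - d / 2) (x + d / 2), mem_nhdsWithin_of_mem_nhds
        (Icc_mem_nhds (by linarith) (by linarith)), ?_⟩
      filter_upwards [hclose (x - d / 2), hclose (x + d / 2)] with i h1 h2 y hy
      have a1 := monotone_cdf (μ i) hy.1
      have a2 := monotone_cdf ν hy.1
      have a3 := monotone_cdf (μ i) hy.2
      have a4 := monotone_cdf ν hy.2
      rw [abs_lt] at h1 h2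
      rw [abs_le]; constructor <;> linarith
  filter_upwards [hmid, hclose A, hclose B] with i h1 h2 h3 x
  rcases lt_or_ge x A with hx | hx
  · have a1 := monotone_cdf (μ i) hx.le
    have a2 := monotone_cdf ν hx.le
    have a3 := cdf_nonneg (μ i) x
    have a4 := cdf_nonneg ν x
    rw [abs_lt] at h2
    rw [abs_le]; constructor <;> linarith
  rcases le_or_gt x B with hx' | hx'
  · exact h1 x ⟨hx, hx'⟩
  · have a1 := monotone_cdf (μ i) hx'.le
    have a2 := monotone_cdf ν hx'.le
    have a3 := cdf_le_one (μ i) x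
    have a4 := cdf_le_one ν x
    rw [abs_lt] at h3
    rw [abs_le]; constructor <;> linarith

theorem continuous_cdf_of_noAtoms (ν : Measure ℝ) [IsProbabilityMeasure ν]
    (h : ∀ x, ν {x} = 0) : Continuous (cdf ν) := by
  refine continuous_iff_continuousAt.mpr fun x => ?_
  rw [(monotone_cdf ν).continuousAt_iff_leftLim_eq_rightLim, (cdf ν).rightLim_eq]
  have h1 := (cdf ν).measure_singleton x
  rw [measure_cdf, h x, eq_comm, ENNReal.ofReal_eq_zero] at h1
  exact le_antisymm ((monotone_cdf ν).leftLim_le le_rfl) (by linarith)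

theorem cdf_gaussianReal_zero_one_div {σ : ℝ} (hσ : 0 < σ) (x : ℝ) :
    cdf (gaussianReal 0 1) (x / σ) = cdf (gaussianReal 0 (.mk (σ ^ 2) (sq_nonneg σ))) x := by
  have h := gaussianReal_map_const_mul (μ := 0) (v := 1) σ
  rw [mul_zero, mul_one] at h
  rw [← h]
  have : IsProbabilityMeasure ((gaussianReal 0 1).map (σ * ·)) :=
    Measure.isProbabilityMeasure_map (by fun_prop)
  rw [cdf_eq_real, cdf_eq_real, map_measureReal_apply (by fun_prop) measurableSet_Iic]
  congr 1
  ext y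
  simp [le_div_iff₀' hσ]

/-- If it failed, counterexamples for `δ = 1 / (n + 1)` and `K = n` would form a triangular array
satisfying Lindeberg's condition, against the central limit theorem and Pólya's theorem. -/
theorem exists_abs_cdf_sumLaw_sub_le {σ : ℝ} (hσ : 0 < σ) {ε : ℝ} (hε : 0 < ε) :
    ∃ δ : ℝ, 0 < δ ∧ ∃ K : ℕ, ∀ (μ : Measure ℝ) [IsProbabilityMeasure μ], MemLp id 2 μ →
      ∀ k ≥ K, |variance id μ - σ ^ 2| ≤ δ → truncVar μ (δ * Real.sqrt k) ≤ δ →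
      ∀ x, |cdf (sumLaw μ k) x - cdf (gaussianReal 0 1) (x / σ)| ≤ ε := by
  by_contra! hcon
  have hpos : ∀ n : ℕ, (0 : ℝ) < 1 / ((n : ℝ) + 1) := fun n => Nat.one_div_pos_of_nat
  choose μ hprob hμ k hk hvar htr x hx using fun n : ℕ => hcon (1 / ((n : ℝ) + 1)) (hpos n) n
  have hδ0 : Tendsto (fun n : ℕ => 1 / ((n : ℝ) + 1)) atTop (𝓝 0) :=
    tendsto_one_div_add_atTop_nhds_zero_nat
  set v : NNReal := .mk (σ ^ 2) (sq_nonneg σ) with hv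
  have hv0 : v ≠ 0 := by
    intro h
    have : (v : ℝ) = 0 := by rw [h]; rfl
    have h2 : σ ^ 2 = 0 := this
    exact hσ.ne' (by simpa using h2)
  have hatom : ∀ y, gaussianReal 0 v {y} = 0 := fun y => by
    have := nullSingletonClass_gaussianReal (μ := 0) hv0
    exact measure_singleton y
  have hvlim : Tendsto (fun n => variance id (μ n)) atTop (𝓝 v) := by
    rw [tendsto_iff_dist_tendsto_zero]
    exact squeeze_zero (fun _ => dist_nonneg) (fun n => hvar n) hδ0
  have hL : ∀ δ : ℝ, 0 < δ →
      Tendsto (fun n => truncVar (μ n) (δ * Real.sqrt (k n))) atTop (𝓝 0) := by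
    intro δ hδ
    refine tendsto_of_tendsto_of_tendsto_of_le_of_le' tendsto_const_nhds hδ0
      (Eventually.of_forall fun n => truncVar_nonneg _ _) ?_
    filter_upwards [hδ0.eventually_le_const hδ] with n hn
    exact (truncVar_anti (hμ n) (mul_le_mul_of_nonneg_right hn (Real.sqrt_nonneg _))).trans (htr n)
  have hcdf := fun y => tendsto_cdf_sumLaw hμ (tendsto_atTop_mono hk tendsto_id) hvlim hL (hatom y)
  have hunif := eventually_abs_cdf_sub_le (continuous_cdf_of_noAtoms _ hatom) hcdf hε
  obtain ⟨n, hn⟩ := hunif.exists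
  have := hx n
  rw [cdf_gaussianReal_zero_one_div hσ] at this
  exact absurd (hn (x n)) (not_le.mpr this)

/-! ### Tail variances: change of centre and weak convergence. -/

/-- The square of the excess of `|u|` over `c`. -/
noncomputable def sqExcess (c u : ℝ) : ℝ := (max (|u| - c) 0) ^ 2

theorem sqExcess_nonneg (c u : ℝ) : 0 ≤ sqExcess c u := sq_nonneg _

@[fun_prop]
theorem continuous_sqExcess (c : ℝ) : Continuous (sqExcess c) := by
  unfold sqExcess; fun_prop

theorem convexOn_sqExcess (c : ℝ) : ConvexOn ℝ Set.univ (sqExcess c) := by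
  have h1 : ConvexOn ℝ Set.univ (fun u : ℝ => |u| + (-c)) :=
    (convexOn_norm convex_univ).add_const (-c)
  have h2 : ConvexOn ℝ Set.univ (fun u : ℝ => max (|u| + (-c)) 0) :=
    h1.sup (convexOn_const 0 convex_univ)
  have h3 := h2.pow (fun _ _ => le_max_right _ _) 2
  exact h3

theorem sq_le_four_mul_sqExcess {c u : ℝ} (hu : 2 * c < |u|) : u ^ 2 ≤ 4 * sqExcess c u := by
  have h0 := abs_nonneg u
  have h1 : |u| / 2 ≤ max (|u| - c) 0 := le_max_of_le_left (by linarith)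
  have h2 : (|u| / 2) ^ 2 ≤ max (|u| - c) 0 ^ 2 := pow_le_pow_left₀ (by positivity) h1 2
  rw [← sq_abs u]
  unfold sqExcess
  linarith

theorem sqExcess_two_mul_add_le (c u w : ℝ) :
    sqExcess (2 * c) (u + w) ≤ 2 * sqExcess c u + 2 * sqExcess c w := by
  unfold sqExcess
  have h1 : max (|u + w| - 2 * c) 0 ≤ max (|u| - c) 0 + max (|w| - c) 0 := by
    refine max_le ?_ (by positivity)
    have := abs_add_le u w
    have := le_max_left (|u| - c) 0
    have := le_max_left (|w| - c) 0
    linarith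
  have h2 := pow_le_pow_left₀ (le_max_right _ _) h1 2
  nlinarith [sq_nonneg (max (|u| - c) 0 - max (|w| - c) 0)]

theorem sqExcess_le_sq_sub_min {c : ℝ} (hc : 0 ≤ c) (u : ℝ) :
    sqExcess c u ≤ u ^ 2 - min (u ^ 2) (c ^ 2) := by
  unfold sqExcess
  rw [← sq_abs u]
  have h0 := abs_nonneg u
  rcases le_total |u| c with h | h
  · rw [max_eq_right (by linarith), min_eq_left (by gcongr)]
    simp
  · rw [max_eq_left (by linarith), min_eq_right (by gcongr)]
    nlinarith

theorem sqExcess_eq_zero {c u : ℝ} (h : |u| ≤ c) : sqExcess c u = 0 := by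
  unfold sqExcess
  rw [max_eq_right (by linarith)]; simp

theorem sqExcess_le_sq {c : ℝ} (hc : 0 ≤ c) (u : ℝ) : sqExcess c u ≤ u ^ 2 := by
  have := sqExcess_le_sq_sub_min hc u
  have : 0 ≤ min (u ^ 2) (c ^ 2) := by positivity
  linarith

theorem integrable_sqExcess_sub {μ : Measure ℝ} [IsProbabilityMeasure μ] (hμ : MemLp id 2 μ)
    {c : ℝ} (hc : 0 ≤ c) (a : ℝ) : Integrable (fun x => sqExcess c (x - a)) μ := by
  refine (integrable_sub_sq hμ a).mono' (by fun_prop) (ae_of_all _ fun x => ?_)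
  rw [Real.norm_eq_abs, abs_of_nonneg (sqExcess_nonneg _ _)]
  exact sqExcess_le_sq hc _

/-- Tails around the mean are controlled by tails around any centre `a`. The excess is convex, so by
Jensen that of `m - a` is at most the mean excess of `x - a`. Halving the level twice, once to pass
to the excess and once to split `x - m`, accounts for `4 * c`. -/
theorem truncVar_le_integral_sqExcess {μ : Measure ℝ} [IsProbabilityMeasure μ]
    (hμ : MemLp id 2 μ) {c : ℝ} (hc : 0 ≤ c) (a : ℝ) :
    truncVar μ (4 * c) ≤ 16 * ∫ x, sqExcess c (x - a) ∂μ := by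
  set m := ∫ x, x ∂μ with hm
  have hi := integrable_sqExcess_sub hμ hc a
  have hid := integrable_id_of_memLp_two hμ
  have hJ : sqExcess c (m - a) ≤ ∫ x, sqExcess c (x - a) ∂μ := by
    have := (convexOn_sqExcess c).map_integral_le (μ := μ) (f := fun x => x - a)
      (continuous_sqExcess c).continuousOn isClosed_univ (by simp)
      (hid.sub (integrable_const a)) hi
    rw [integral_sub hid (integrable_const a)] at this
    simpa [← hm] using this
  have hJ' : sqExcess c (a - m) ≤ ∫ x, sqExcess c (x - a) ∂μ := by
    have : sqExcess c (a - m) = sqExcess c (m - a) := by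
      unfold sqExcess; rw [abs_sub_comm]
    rwa [this]
  calc truncVar μ (4 * c)
      ≤ ∫ x, (8 * sqExcess c (x - a) + 8 * sqExcess c (a - m)) ∂μ := by
        refine integral_mono (integrable_truncated_sq hμ _)
          ((hi.const_mul 8).add (integrable_const _)) fun x => ?_
        have h0 := sqExcess_nonneg c (x - a)
        have h0' := sqExcess_nonneg c (a - m)
        by_cases hx : 4 * c < |x - m|
        · have h1 := sq_le_four_mul_sqExcess (c := 2 * c) (u := x - m) (by linarith)
          have h2 := sqExcess_two_mul_add_le c (x - a) (a - m)
          rw [sub_add_sub_cancel] at h2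
          rw [Set.indicator_of_mem (by simpa [← hm] using hx), ← hm]
          linarith
        · rw [Set.indicator_of_notMem (by simpa [← hm] using hx)]
          positivity
    _ = 8 * ∫ x, sqExcess c (x - a) ∂μ + 8 * sqExcess c (a - m) := by
        rw [integral_add (hi.const_mul 8) (integrable_const _), integral_const_mul]
        simp
    _ ≤ _ := by linarith

/-- The expectation of `min ((Y - Y')^2, c^2)` for independent `Y`, `Y'` with law `μ`. -/
noncomputable def truncDispersion (c : ℝ) (μ : Measure ℝ) : ℝ :=
  ∫ p : ℝ × ℝ, min ((p.1 - p.2) ^ 2) (c ^ 2) ∂(μ.prod μ)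

theorem integrable_min_sq {μ : Measure ℝ} [IsProbabilityMeasure μ] (c : ℝ) :
    Integrable (fun p : ℝ × ℝ => min ((p.1 - p.2) ^ 2) (c ^ 2)) (μ.prod μ) := by
  refine (integrable_const (c ^ 2)).mono' (by fun_prop) (ae_of_all _ fun p => ?_)
  rw [Real.norm_eq_abs, abs_of_nonneg (by positivity)]
  exact min_le_right _ _

theorem integrable_sq_fst_sub_snd {μ : Measure ℝ} [IsProbabilityMeasure μ] (hμ : MemLp id 2 μ) :
    Integrable (fun p : ℝ × ℝ => (p.1 - p.2) ^ 2) (μ.prod μ) := by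
  have h1 : MemLp (fun p : ℝ × ℝ => p.1) 2 (μ.prod μ) := hμ.comp_fst μ
  have h2 : MemLp (fun p : ℝ × ℝ => p.2) 2 (μ.prod μ) := hμ.comp_snd μ
  exact (h1.sub h2).integrable_sq

theorem integral_sq_fst_sub_snd {μ : Measure ℝ} [IsProbabilityMeasure μ] (hμ : MemLp id 2 μ) :
    ∫ p : ℝ × ℝ, (p.1 - p.2) ^ 2 ∂(μ.prod μ) = 2 * variance id μ := by
  set m := ∫ x, x ∂μ with hm
  have hi1 : Integrable (fun x => x - m) μ :=
    (integrable_id_of_memLp_two hμ).sub (integrable_const m)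
  have hi2 := integrable_sub_sq hμ m
  have h0 : ∫ x, (x - m) ∂μ = 0 := by
    rw [integral_sub (integrable_id_of_memLp_two hμ) (integrable_const m)]
    simp [hm]
  have e : ∀ p : ℝ × ℝ, (p.1 - p.2) ^ 2
      = ((p.1 - m) ^ 2 + (p.2 - m) ^ 2) - 2 * ((p.1 - m) * (p.2 - m)) := fun p => by ring
  have j1 : Integrable (fun p : ℝ × ℝ => (p.1 - m) ^ 2) (μ.prod μ) := hi2.comp_fst μ
  have j2 : Integrable (fun p : ℝ × ℝ => (p.2 - m) ^ 2) (μ.prod μ) := hi2.comp_snd μ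
  have j3 : Integrable (fun p : ℝ × ℝ => (p.1 - m) * (p.2 - m)) (μ.prod μ) := hi1.mul_prod hi1
  simp_rw [e]
  have j4 : Integrable (fun p : ℝ × ℝ => (p.1 - m) ^ 2 + (p.2 - m) ^ 2) (μ.prod μ) := j1.add j2
  rw [integral_sub j4 (j3.const_mul 2), integral_add j1 j2, integral_const_mul,
    integral_prod_mul (fun x => x - m) (fun x => x - m), h0,
    integral_fun_fst (fun x => (x - m) ^ 2), integral_fun_snd (fun x => (x - m) ^ 2),
    variance_id_eq]
  simp
  ring

/-- Take the centre to be an independent copy and average over it. The right side avoids the mean,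
which is not weakly continuous: `truncDispersion` integrates a bounded continuous function, so only
convergence of the variances is needed besides weak convergence. -/
theorem truncVar_le_sub_truncDispersion {μ : Measure ℝ} [IsProbabilityMeasure μ]
    (hμ : MemLp id 2 μ) {c : ℝ} (hc : 0 ≤ c) :
    truncVar μ (4 * c) ≤ 16 * (2 * variance id μ - truncDispersion c μ) := by
  have hsq := integrable_sq_fst_sub_snd hμ
  have hmin := integrable_min_sq (μ := μ) c
  have hex : Integrable (fun p : ℝ × ℝ => sqExcess c (p.1 - p.2)) (μ.prod μ) := by
    refine hsq.mono' (by fun_prop) (ae_of_all _ fun p => ?_)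
    rw [Real.norm_eq_abs, abs_of_nonneg (sqExcess_nonneg _ _)]
    exact sqExcess_le_sq hc _
  have h1 : truncVar μ (4 * c) ≤ 16 * ∫ p : ℝ × ℝ, sqExcess c (p.1 - p.2) ∂(μ.prod μ) := by
    rw [integral_prod_symm _ hex, ← integral_const_mul]
    have := integral_mono (μ := μ) (integrable_const (truncVar μ (4 * c)))
      (hex.integral_prod_right.const_mul 16) fun a => truncVar_le_integral_sqExcess hμ hc a
    simpa using this
  refine h1.trans (mul_le_mul_of_nonneg_left ?_ (by norm_num))
  rw [← integral_sq_fst_sub_snd hμ, truncDispersion, ← integral_sub hsq hmin]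
  exact integral_mono hex (hsq.sub hmin) fun p => sqExcess_le_sq_sub_min hc _

theorem tendsto_truncDispersion {μ : Measure ℝ} [IsProbabilityMeasure μ] (hμ : MemLp id 2 μ) :
    Tendsto (fun c : ℝ => truncDispersion c μ) atTop (𝓝 (2 * variance id μ)) := by
  rw [← integral_sq_fst_sub_snd hμ]
  refine tendsto_integral_filter_of_dominated_convergence (fun p => (p.1 - p.2) ^ 2)
    (Eventually.of_forall fun c => by fun_prop) (Eventually.of_forall fun c => ?_)
    (integrable_sq_fst_sub_snd hμ) (ae_of_all _ fun p => ?_)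
  · refine ae_of_all _ fun p => ?_
    rw [Real.norm_eq_abs, abs_of_nonneg (by positivity)]
    exact min_le_left _ _
  · refine tendsto_const_nhds.congr' ?_
    filter_upwards [eventually_ge_atTop |p.1 - p.2|] with c hc
    rw [min_eq_left]
    exact sq_le_sq' (by linarith [neg_abs_le (p.1 - p.2)]) ((le_abs_self _).trans hc)

theorem tendsto_truncDispersion_of_tendsto {μ : ℕ → ProbabilityMeasure ℝ}
    {ν : ProbabilityMeasure ℝ} (h : Tendsto μ atTop (𝓝 ν)) (c : ℝ) :
    Tendsto (fun n => truncDispersion c (μ n : Measure ℝ)) atTop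
      (𝓝 (truncDispersion c (ν : Measure ℝ))) := by
  have hp : Tendsto (fun n => (μ n).prod (μ n)) atTop (𝓝 (ν.prod ν)) :=
    (ProbabilityMeasure.continuous_prod.tendsto (ν, ν)).comp (h.prodMk_nhds h)
  have := ProbabilityMeasure.tendsto_iff_forall_integral_tendsto.mp hp
    (BoundedContinuousFunction.mkOfBound
      ⟨fun p : ℝ × ℝ => min ((p.1 - p.2) ^ 2) (c ^ 2), by fun_prop⟩ (c ^ 2) (fun p q => by
        have h1 : 0 ≤ min ((p.1 - p.2) ^ 2) (c ^ 2) := by positivity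
        have h2 : 0 ≤ min ((q.1 - q.2) ^ 2) (c ^ 2) := by positivity
        have h3 := min_le_right ((p.1 - p.2) ^ 2) (c ^ 2)
        have h4 := min_le_right ((q.1 - q.2) ^ 2) (c ^ 2)
        simp only [ContinuousMap.coe_mk]
        rw [Real.dist_eq, abs_le]
        constructor <;> linarith))
  exact this

/-- Half-open intervals with endpoints in `D` form a π-system that contains arbitrarily small
neighbourhoods of each point. -/
theorem tendsto_of_tendsto_cdf_of_dense {μ : ℕ → ProbabilityMeasure ℝ}
    {ν : ProbabilityMeasure ℝ} {D : Set ℝ} (hD : Dense D)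
    (h : ∀ x ∈ D, Tendsto (fun n => cdf (μ n : Measure ℝ) x) atTop (𝓝 (cdf (ν : Measure ℝ) x))) :
    Tendsto μ atTop (𝓝 ν) := by
  refine (isPiSystem_Ioc_mem D D).tendsto_probabilityMeasure_of_tendsto_of_mem ?_ ?_ ?_
  · rintro s ⟨a, _, b, _, _, rfl⟩
    exact measurableSet_Ioc
  · intro u hu x hx
    obtain ⟨ε, hε, hball⟩ := Metric.isOpen_iff.mp hu x hx
    obtain ⟨a, haD, ha⟩ := hD.exists_between (show x - ε < x by linarith)
    obtain ⟨b, hbD, hb⟩ := hD.exists_between (show x < x + ε by linarith)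
    refine ⟨Set.Ioc a b, ⟨a, haD, b, hbD, ha.2.trans hb.1, rfl⟩, Ioc_mem_nhds ha.2 hb.1, ?_⟩
    intro y hy
    refine hball ?_
    rw [Metric.mem_ball, Real.dist_eq, abs_lt]
    constructor <;> linarith [hy.1, hy.2, ha.1, hb.2]
  · rintro s ⟨a, ha, b, hb, hab, rfl⟩
    have key : ∀ κ : ProbabilityMeasure ℝ, κ (Set.Ioc a b)
        = Real.toNNReal (cdf (κ : Measure ℝ) b - cdf (κ : Measure ℝ) a) := by
      intro κ
      have h1 : (κ : Measure ℝ) (Set.Ioc a b)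
          = ENNReal.ofReal (cdf (κ : Measure ℝ) b - cdf (κ : Measure ℝ) a) := by
        conv_lhs => rw [← measure_cdf (κ : Measure ℝ)]
        exact StieltjesFunction.measure_Ioc _ _ _
      change ((κ : Measure ℝ) (Set.Ioc a b)).toNNReal = _
      rw [h1]
      rfl
    simp_rw [key]
    exact (continuous_real_toNNReal.tendsto _).comp ((h b hb).sub (h a ha))

/-- If `μ` is close to `J` at finitely many continuity points and has nearly the same variance,
then its tails contribute little to its variance. -/
theorem exists_truncVar_le_of_cdf_close {J : Measure ℝ} [IsProbabilityMeasure J]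
    (hJ : MemLp id 2 J) {δ : ℝ} (hδ : 0 < δ) :
    ∃ c : ℝ, ∃ s : Finset ℝ, (∀ x ∈ s, ContinuousAt (cdf J) x) ∧ ∃ η : ℝ, 0 < η ∧
      ∀ (μ : Measure ℝ) [IsProbabilityMeasure μ], MemLp id 2 μ →
        (∀ x ∈ s, |cdf μ x - cdf J x| < η) → |variance id μ - variance id J| < η →
        truncVar μ c ≤ δ := by
  obtain ⟨c, hc, hc0⟩ := (((tendsto_truncDispersion hJ).eventually_const_lt
    (show 2 * variance id J - δ / 16 < 2 * variance id J by linarith)).and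
      (eventually_ge_atTop 0)).exists
  -- The `n`-th counterexample below is close to `J` at the first `n` points of a countable dense
  -- set of continuity points, so the counterexamples converge weakly to `J`.
  have hdense : Dense {x | ContinuousAt (cdf J) x} := by
    have := (monotone_cdf J).countable_not_continuousAt.dense_compl ℝ
    convert this using 1
    ext x; simp
  obtain ⟨D, hDsub, hDc, hD⟩ := hdense.exists_countable_dense_subset
  obtain ⟨d, rfl⟩ := hDc.exists_eq_range hD.nonempty
  by_contra! hcon
  have hpos : ∀ n : ℕ, (0 : ℝ) < 1 / ((n : ℝ) + 1) := fun n => Nat.one_div_pos_of_nat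
  choose μ hprob hμ hcdf hvar htr using fun n : ℕ => hcon (4 * c) ((Finset.range n).image d)
    (by
      intro x hx
      obtain ⟨j, _, rfl⟩ := Finset.mem_image.mp hx
      exact hDsub ⟨j, rfl⟩) (1 / ((n : ℝ) + 1)) (hpos n)
  have hδ0 : Tendsto (fun n : ℕ => 1 / ((n : ℝ) + 1)) atTop (𝓝 0) :=
    tendsto_one_div_add_atTop_nhds_zero_nat
  let κ : ℕ → ProbabilityMeasure ℝ := fun n => ⟨μ n, hprob n⟩
  let ν : ProbabilityMeasure ℝ := ⟨J, inferInstance⟩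
  have hκ : Tendsto κ atTop (𝓝 ν) := by
    refine tendsto_of_tendsto_cdf_of_dense hD ?_
    rintro _ ⟨j, rfl⟩
    rw [tendsto_iff_dist_tendsto_zero]
    refine squeeze_zero' (Eventually.of_forall fun _ => dist_nonneg) ?_ hδ0
    filter_upwards [eventually_gt_atTop j] with n hn
    exact (hcdf n (d j) (Finset.mem_image_of_mem d (Finset.mem_range.mpr hn))).le
  have hG := tendsto_truncDispersion_of_tendsto hκ c
  have hvlim : Tendsto (fun n => variance id (μ n)) atTop (𝓝 (variance id J)) := by
    rw [tendsto_iff_dist_tendsto_zero]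
    exact squeeze_zero (fun _ => dist_nonneg) (fun n => (hvar n).le) hδ0
  have hlim := ((hvlim.const_mul 2).sub hG).const_mul 16
  have hlt : 16 * (2 * variance id J - truncDispersion c (ν : Measure ℝ)) < δ := by
    change 16 * (2 * variance id J - truncDispersion c J) < δ
    linarith
  obtain ⟨n, hn⟩ := (hlim.eventually_lt_const hlt).exists
  exact absurd ((truncVar_le_sub_truncDispersion (hμ n) hc0).trans_lt hn) (not_lt.mpr (htr n).le)

/-! ### The conditional central limit theorem for random laws. -/

variable {Ω : Type*}

/-- The random laws `ν n` have tails that contribute little to their variances, in probability. -/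
def TailsNegligible [MeasurableSpace Ω] (P : Measure Ω) (ν : ℕ → Ω → Measure ℝ) : Prop :=
  ∀ δ : ℝ, 0 < δ → ∀ η : ENNReal, 0 < η → ∃ c : ℝ,
    ∀ᶠ n in atTop, P {ω | δ < truncVar (ν n ω) c} ≤ η

theorem bddAbove_range_abs_cdf_sub (μ ν : Measure ℝ) (f : ℝ → ℝ) :
    BddAbove (Set.range fun x => |cdf μ x - cdf ν (f x)|) := by
  refine ⟨1, ?_⟩
  rintro _ ⟨x, rfl⟩
  have a1 := cdf_nonneg μ x
  have a2 := cdf_le_one μ x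
  have a3 := cdf_nonneg ν (f x)
  have a4 := cdf_le_one ν (f x)
  simp only [abs_le]
  constructor <;> linarith

/-- Conditional central limit theorem for random laws with negligible tails. -/
theorem tendstoInMeasure_iSup_cdf_sumLaw [MeasurableSpace Ω] {P : Measure Ω}
    {ν : ℕ → Ω → Measure ℝ} [∀ n ω, IsProbabilityMeasure (ν n ω)]
    (hν : ∀ n ω, MemLp id 2 (ν n ω)) (htail : TailsNegligible P ν) {σ : ℝ} (hσ : 0 < σ)
    (hvar : TendstoInMeasure P (fun n ω => variance id (ν n ω)) atTop (fun _ => σ ^ 2))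
    {k : ℕ → ℕ} (hk : Tendsto k atTop atTop) :
    TendstoInMeasure P (fun n ω => ⨆ x : ℝ, |cdf (sumLaw (ν n ω) (k n)) x
      - cdf (gaussianReal 0 1) (x / σ)|) atTop (fun _ => 0) := by
  rw [tendstoInMeasure_iff_norm] at hvar ⊢
  intro ε hε
  obtain ⟨δ, hδ, K, hK⟩ := exists_abs_cdf_sumLaw_sub_le hσ (half_pos hε)
  rw [ENNReal.tendsto_nhds_zero]
  intro η hη
  have hη2 : 0 < η / 2 := ENNReal.half_pos hη.ne'
  obtain ⟨c, hc⟩ := htail δ hδ (η / 2) hη2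
  -- Since `k n → ∞`, the Lindeberg level eventually passes the fixed level `c` supplied by the tail
  -- condition.
  have hsqrt : Tendsto (fun n => δ * Real.sqrt (k n)) atTop atTop :=
    (Real.tendsto_sqrt_atTop.comp (tendsto_natCast_atTop_atTop.comp hk)).const_mul_atTop hδ
  filter_upwards [hc, ENNReal.tendsto_nhds_zero.mp (hvar δ hδ) (η / 2) hη2,
    hsqrt.eventually_ge_atTop c, hk.eventually_ge_atTop K] with n h1 h2 h3 h4
  calc P {ω | ε ≤ ‖(⨆ x : ℝ, |cdf (sumLaw (ν n ω) (k n)) x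
        - cdf (gaussianReal 0 1) (x / σ)|) - 0‖}
      ≤ P ({ω | δ < truncVar (ν n ω) c} ∪ {ω | δ ≤ ‖variance id (ν n ω) - σ ^ 2‖}) := by
        refine measure_mono fun ω hω => ?_
        by_contra hcon
        simp only [Set.mem_union, Set.mem_ofPred_eq, not_or, not_lt, not_le] at hcon hω
        have hsup := hK (ν n ω) (hν n ω) (k n) h4 hcon.2.le
          ((truncVar_anti (hν n ω) h3).trans hcon.1)
        have hle := ciSup_le hsup
        have h0 : 0 ≤ ⨆ x : ℝ, |cdf (sumLaw (ν n ω) (k n)) x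
            - cdf (gaussianReal 0 1) (x / σ)| := Real.iSup_nonneg fun _ => abs_nonneg _
        rw [sub_zero, Real.norm_eq_abs, abs_of_nonneg h0] at hω
        linarith
    _ ≤ η / 2 + η / 2 := (measure_union_le _ _).trans (add_le_add h1 h2)
    _ = η := ENNReal.add_halves η

/-! ### Recovering the variance from asymptotic normality. -/

theorem tendsto_truncVar_atTop {μ : Measure ℝ} [IsProbabilityMeasure μ] (hμ : MemLp id 2 μ) :
    Tendsto (truncVar μ) atTop (𝓝 0) := by
  have : (0 : ℝ) = ∫ _ : ℝ, (0 : ℝ) ∂μ := by simp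
  rw [this]
  refine tendsto_integral_filter_of_dominated_convergence (fun x => (x - ∫ x, x ∂μ) ^ 2)
    (Eventually.of_forall fun c => (integrable_truncated_sq hμ c).aestronglyMeasurable)
    (Eventually.of_forall fun c => ae_of_all _ fun x => ?_) (integrable_sub_sq hμ _)
    (ae_of_all _ fun x => ?_)
  · rw [Real.norm_eq_abs, abs_of_nonneg (Set.indicator_nonneg (fun _ _ => sq_nonneg _) x)]
    exact Set.indicator_le_self' (fun _ _ => sq_nonneg _) x
  · refine tendsto_const_nhds.congr' ?_
    filter_upwards [eventually_ge_atTop |x - ∫ x, x ∂μ|] with c hc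
    rw [Set.indicator_of_notMem]
    simpa using hc

/-- Evaluating at `1` rather than `0` covers `v = 0`, where all analogs coincide and the limit is
the point mass at `0`. -/
theorem gaussianReal_zero_singleton_one (v : NNReal) : gaussianReal 0 v {1} = 0 := by
  by_cases hv : v = 0
  · simp [hv, gaussianReal_zero_var]
  · have := nullSingletonClass_gaussianReal (μ := 0) hv
    exact measure_singleton 1

theorem tendsto_cdf_sumLaw_one {μ : Measure ℝ} [IsProbabilityMeasure μ] (hμ : MemLp id 2 μ) :
    Tendsto (fun k => cdf (sumLaw μ k) 1) atTop
      (𝓝 (cdf (gaussianReal 0 (variance id μ).toNNReal) 1)) := by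
  refine tendsto_cdf_sumLaw (μ := fun _ => μ) (fun _ => hμ) tendsto_id ?_ (fun δ hδ => ?_)
    (gaussianReal_zero_singleton_one _)
  · rw [Real.coe_toNNReal _ (variance_nonneg _ _)]
    exact tendsto_const_nhds
  · exact (tendsto_truncVar_atTop hμ).comp
      ((Real.tendsto_sqrt_atTop.comp tendsto_natCast_atTop_atTop).const_mul_atTop hδ)

theorem strictMono_cdf_gaussianReal {v : NNReal} (hv : v ≠ 0) :
    StrictMono (cdf (gaussianReal 0 v)) := by
  intro a b hab
  by_contra hcon
  have h1 := (cdf (gaussianReal 0 v)).measure_Ioc a b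
  rw [measure_cdf, ENNReal.ofReal_of_nonpos (by linarith)] at h1
  have h2 := gaussianReal_absolutelyContinuous' 0 hv h1
  rw [Real.volume_Ioc, ENNReal.ofReal_eq_zero] at h2
  linarith

theorem strictAntiOn_cdf_gaussianReal_one :
    StrictAntiOn (fun v : ℝ => cdf (gaussianReal 0 v.toNNReal) 1) (Set.Ici 0) := by
  have key : ∀ v : ℝ, 0 < v → cdf (gaussianReal 0 v.toNNReal) 1
      = cdf (gaussianReal 0 1) (1 / Real.sqrt v) := by
    intro v hv
    rw [cdf_gaussianReal_zero_one_div (Real.sqrt_pos.mpr hv)]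
    congr 3
    ext
    simp [Real.sq_sqrt hv.le, hv.le]
  intro v hv w _ hvw
  have hw : 0 < w := lt_of_le_of_lt hv hvw
  simp only
  rw [key w hw]
  -- At `v = 0` the formula `key` fails because `1 / √0` is `0` by convention; the distribution
  -- function is then `1`, which no nondegenerate normal law attains.
  rcases (show (0 : ℝ) ≤ v from hv).eq_or_lt with rfl | hv'
  · have h1 : cdf (gaussianReal 0 (0 : ℝ).toNNReal) 1 = 1 := by
      rw [cdf_eq_real, Real.toNNReal_zero, gaussianReal_zero_var]
      simp [Measure.real]
    rw [h1]
    exact (strictMono_cdf_gaussianReal one_ne_zero (lt_add_one _)).trans_le (cdf_le_one _ _)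
  · rw [key v hv']
    refine strictMono_cdf_gaussianReal one_ne_zero ?_
    exact one_div_lt_one_div_of_lt (Real.sqrt_pos.mpr hv') (Real.sqrt_lt_sqrt hv'.le hvw)

/-- If the convolved laws are asymptotically normal however slowly or fast the number of summands
grows, then the variances converge. -/
theorem tendstoInMeasure_variance_of_forall_iSup [MeasurableSpace Ω] {P : Measure Ω}
    [IsProbabilityMeasure P] {ν : ℕ → Ω → Measure ℝ} [∀ n ω, IsProbabilityMeasure (ν n ω)]
    (hν : ∀ n ω, MemLp id 2 (ν n ω)) {n₀ : ℕ}
    (hmeas : ∀ n ≥ n₀, ∀ k, Measurable fun ω => cdf (sumLaw (ν n ω) k) 1)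
    {σ : ℝ} (hσ : 0 < σ)
    (h : ∀ k : ℕ → ℕ, (∀ n, 1 ≤ k n) → Tendsto k atTop atTop →
      TendstoInMeasure P (fun n ω => ⨆ x : ℝ, |cdf (sumLaw (ν n ω) (k n)) x
        - cdf (gaussianReal 0 1) (x / σ)|) atTop (fun _ => 0)) :
    TendstoInMeasure P (fun n ω => variance id (ν n ω)) atTop (fun _ => σ ^ 2) := by
  set g : ℝ → ℝ := fun v => cdf (gaussianReal 0 v.toNNReal) 1 with hg
  have hanti : StrictAntiOn g (Set.Ici 0) := strictAntiOn_cdf_gaussianReal_one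
  have hgσ : cdf (gaussianReal 0 1) (1 / σ) = g (σ ^ 2) := by
    rw [cdf_gaussianReal_zero_one_div hσ, hg]
    congr 3
    ext
    simp [sq_nonneg]
  -- Convergence almost everywhere as `k → ∞` becomes convergence in probability for each fixed `n`,
  -- so one large `k` suffices; `n + 1 ≤ k` makes the chosen sequence positive and divergent.
  have hchoice : ∀ n, ∃ k : ℕ, n + 1 ≤ k ∧ (n₀ ≤ n →
      P {ω | 1 / ((n : ℝ) + 1) ≤ ‖cdf (sumLaw (ν n ω) k) 1 - g (variance id (ν n ω))‖}
        ≤ ENNReal.ofReal (1 / ((n : ℝ) + 1))) := by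
    intro n
    by_cases hn : n₀ ≤ n
    · have hm := tendstoInMeasure_of_tendsto_ae (μ := P)
        (fun k => (hmeas n hn k).aestronglyMeasurable)
        (ae_of_all _ fun ω => tendsto_cdf_sumLaw_one (hν n ω))
      rw [tendstoInMeasure_iff_norm] at hm
      have hm' := ENNReal.tendsto_nhds_zero.mp (hm (1 / ((n : ℝ) + 1)) Nat.one_div_pos_of_nat)
        (ENNReal.ofReal (1 / ((n : ℝ) + 1))) (ENNReal.ofReal_pos.mpr Nat.one_div_pos_of_nat)
      obtain ⟨k, hk, hk'⟩ := (hm'.and (eventually_ge_atTop (n + 1))).exists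
      exact ⟨k, hk', fun _ => hk⟩
    · exact ⟨n + 1, le_rfl, fun hn' => absurd hn' hn⟩
  choose k hk hkP using hchoice
  have hsup := h k (fun n => le_of_add_le_right (hk n))
    (tendsto_atTop_mono (fun n => (Nat.le_succ n).trans (hk n)) tendsto_id)
  rw [tendstoInMeasure_iff_norm] at hsup ⊢
  intro ε hε
  -- Strict monotonicity of `g` separates values: `v` at distance `ε` from `σ ^ 2` moves `g` by at
  -- least `ρ`. The lower comparison point is cut at `0` to stay where `g` is monotone.
  obtain ⟨ρ, hρ, hsep⟩ : ∃ ρ : ℝ, 0 < ρ ∧ ∀ v : ℝ, 0 ≤ v → ε ≤ ‖v - σ ^ 2‖ →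
      ρ ≤ |g v - g (σ ^ 2)| := by
    have hσ2 : 0 < σ ^ 2 := by positivity
    have h1 : g (σ ^ 2 + ε) < g (σ ^ 2) :=
      hanti hσ2.le (Set.mem_Ici.mpr (by linarith)) (by linarith)
    have h2 : g (σ ^ 2) < g (max (σ ^ 2 - ε) 0) :=
      hanti (Set.mem_Ici.mpr (le_max_right _ _)) hσ2.le (max_lt (by linarith) hσ2)
    refine ⟨min (g (σ ^ 2) - g (σ ^ 2 + ε)) (g (max (σ ^ 2 - ε) 0) - g (σ ^ 2)),
      lt_min (by linarith) (by linarith), fun v hv hvε => ?_⟩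
    rw [Real.norm_eq_abs] at hvε
    rcases le_abs'.mp hvε with h3 | h3
    · refine (min_le_right _ _).trans (le_trans ?_ (le_abs_self _))
      have := hanti.antitoneOn (Set.mem_Ici.mpr hv) (Set.mem_Ici.mpr (le_max_right _ _))
        (show v ≤ max (σ ^ 2 - ε) 0 from le_max_of_le_left (by linarith))
      linarith
    · refine (min_le_left _ _).trans (le_trans ?_ (neg_le_abs _))
      have := hanti.antitoneOn (Set.mem_Ici.mpr (by linarith : 0 ≤ σ ^ 2 + ε))
        (Set.mem_Ici.mpr hv) (show σ ^ 2 + ε ≤ v by linarith)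
      linarith
  have hδ0 : Tendsto (fun n : ℕ => 1 / ((n : ℝ) + 1)) atTop (𝓝 0) :=
    tendsto_one_div_add_atTop_nhds_zero_nat
  have hlim := (hsup (ρ / 2) (half_pos hρ)).add
    ((ENNReal.continuous_ofReal.tendsto 0).comp hδ0)
  rw [ENNReal.ofReal_zero, add_zero] at hlim
  refine tendsto_of_tendsto_of_tendsto_of_le_of_le' tendsto_const_nhds hlim
    (Eventually.of_forall fun _ => zero_le) ?_
  filter_upwards [eventually_ge_atTop n₀, hδ0.eventually_lt_const (half_pos hρ)] with n hn hnρ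
  refine le_trans (measure_mono fun ω hω => ?_)
    ((measure_union_le _ _).trans (add_le_add le_rfl (hkP n hn)))
  by_contra hcon
  simp only [Set.mem_union, Set.mem_ofPred_eq, not_or, not_le] at hcon hω
  have h1 := hsep _ (variance_nonneg _ _) hω
  have h2 := le_ciSup (bddAbove_range_abs_cdf_sub (sumLaw (ν n ω) (k n)) (gaussianReal 0 1)
    (fun x => x / σ)) 1
  have h3 := hcon.1
  rw [sub_zero] at h3
  have h4 := (h2.trans (le_abs_self _)).trans_lt h3
  rw [hgσ] at h4
  have h5 := hcon.2
  rw [Real.norm_eq_abs] at h5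
  have h6 := abs_sub_le (g (variance id (ν n ω))) (cdf (sumLaw (ν n ω) (k n)) 1) (g (σ ^ 2))
  rw [abs_sub_comm (g (variance id (ν n ω))) (cdf (sumLaw (ν n ω) (k n)) 1)] at h6
  linarith

/-! ### The subsampling law as an empirical measure. -/

section Empirical

variable (t : (m : ℕ) → (Fin m → ℝ) → ℝ) (τ : ℕ → ℝ) (X : ℕ → Ω → ℝ) (n b : ℕ) (ω : Ω)

theorem integrable_subLaw (f : ℝ → ℝ) : Integrable f (subLaw t τ X n b ω) := by
  refine Integrable.smul_measure ?_ (by simp [numBlocks])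
  exact integrable_finsetSum_measure.mpr fun i _ => integrable_dirac enorm_lt_top

theorem integral_subLaw (f : ℝ → ℝ) :
    ∫ x, f x ∂(subLaw t τ X n b ω)
      = (numBlocks n b : ℝ)⁻¹ * ∑ i ∈ Finset.Icc 1 (numBlocks n b), f (analog t τ X n b i ω) := by
  rw [subLaw, integral_smul_measure,
    integral_finsetSum_measure (fun i _ => integrable_dirac enorm_lt_top)]
  simp

theorem memLp_subLaw : MemLp id 2 (subLaw t τ X n b ω) :=
  (memLp_two_iff_integrable_sq aestronglyMeasurable_id).mpr (integrable_subLaw t τ X n b ω _)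

theorem integral_id_subLaw : ∫ x, x ∂(subLaw t τ X n b ω) = subMean t τ X n b ω :=
  integral_subLaw t τ X n b ω fun x => x

theorem variance_subLaw : variance id (subLaw t τ X n b ω) = subVar t τ X n b ω := by
  rw [variance_id_eq, integral_id_subLaw, integral_subLaw]
  rfl

theorem cdf_subLaw (x : ℝ) : cdf (subLaw t τ X n b ω) x = subCDF t τ X n b x ω := by
  rw [cdf_eq_real, subLaw_real_Iic]

theorem cdf_sumLaw_subLaw (k : ℕ) (x : ℝ) :
    cdf (sumLaw (subLaw t τ X n b ω) k) x = convCDF t τ X n b k x ω := by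
  rw [cdf_eq_real, sumLaw, map_measureReal_apply (measurable_normalizedSum k _) measurableSet_Iic,
    integral_id_subLaw]
  rfl

/-- The uniform distribution on the indices of the blocks. -/
noncomputable def indexLaw (N : ℕ) : Measure ℕ :=
  (N : ENNReal)⁻¹ • ∑ i ∈ Finset.Icc 1 N, Measure.dirac i

theorem map_indexLaw :
    (indexLaw (numBlocks n b)).map (fun i => analog t τ X n b (max i 1) ω)
      = subLaw t τ X n b ω := by
  have hm : Measurable (fun i : ℕ => analog t τ X n b (max i 1) ω) := measurable_from_top
  rw [indexLaw, subLaw, Measure.map_smul, ← Measure.mapₗ_apply_of_measurable hm, map_sum]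
  congr 1
  refine Finset.sum_congr rfl fun i hi => ?_
  rw [Measure.mapₗ_apply_of_measurable hm, Measure.map_dirac' hm,
    max_eq_left (Finset.mem_Icc.mp hi).1]

instance isProbabilityMeasure_indexLaw : IsProbabilityMeasure (indexLaw (numBlocks n b)) := by
  constructor
  have h : (numBlocks n b : ENNReal) ≠ 0 := by simp [numBlocks]
  simp [indexLaw, ENNReal.inv_mul_cancel h (ENNReal.natCast_ne_top _)]

/-- Drawing block indices instead of values makes the product measure independent of `ω`; only the
event varies, which gives measurability in `ω`. Replacing `i` by `max i 1` changes nothing on the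
support and keeps every index where the process is known to be measurable. -/
theorem convCDF_eq_indexLaw (k : ℕ) (x : ℝ) :
    convCDF t τ X n b k x ω
      = (Measure.pi fun _ : Fin k => indexLaw (numBlocks n b)).real
        {f | (Real.sqrt k)⁻¹ * ∑ j, (analog t τ X n b (max (f j) 1) ω - subMean t τ X n b ω)
          ≤ x} := by
  have hm : Measurable (fun i : ℕ => analog t τ X n b (max i 1) ω) := measurable_from_top
  have : IsProbabilityMeasure ((indexLaw (numBlocks n b)).map
      (fun i => analog t τ X n b (max i 1) ω)) :=
    Measure.isProbabilityMeasure_map hm.aemeasurable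
  rw [convCDF]
  conv_lhs =>
    rw [← map_indexLaw t τ X n b ω]
  rw [← Measure.pi_map_pi (f := fun _ i => analog t τ X n b (max i 1) ω)
    (fun _ => hm.aemeasurable)]
  rw [map_measureReal_apply (by fun_prop)
    (measurableSet_le (measurable_normalizedSum k _) measurable_const)]
  rfl

end Empirical

/-! ### Measurability of the convolved distribution function. -/

section Measurability

variable [MeasurableSpace Ω] {t : (m : ℕ) → (Fin m → ℝ) → ℝ} {τ : ℕ → ℝ} {X : ℕ → Ω → ℝ}

theorem measurable_stat (hX : ∀ i, 1 ≤ i → Measurable (X i)) (ht : ∀ m, 1 ≤ m → Measurable (t m))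
    {i m : ℕ} (hi : 1 ≤ i) (hm : 1 ≤ m) : Measurable (stat t X i m) :=
  (ht m hm).comp (measurable_pi_lambda _ fun j => hX (i + j) (by omega))

theorem measurable_analog (hX : ∀ i, 1 ≤ i → Measurable (X i))
    (ht : ∀ m, 1 ≤ m → Measurable (t m)) {n b i : ℕ} (hn : 1 ≤ n) (hb : 1 ≤ b) (hi : 1 ≤ i) :
    Measurable (analog t τ X n b i) :=
  ((measurable_stat hX ht hi hb).sub (measurable_stat hX ht le_rfl hn)).const_mul _

theorem measurable_scaledError (hX : ∀ i, 1 ≤ i → Measurable (X i))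
    (ht : ∀ m, 1 ≤ m → Measurable (t m)) {θ : ℝ} {b i : ℕ} (hb : 1 ≤ b) (hi : 1 ≤ i) :
    Measurable (scaledError t τ θ X i b) :=
  ((measurable_stat hX ht hi hb).sub_const _).const_mul _

theorem measurable_convCDF (hX : ∀ i, 1 ≤ i → Measurable (X i))
    (ht : ∀ m, 1 ≤ m → Measurable (t m)) {n b : ℕ} (hn : 1 ≤ n) (hb : 1 ≤ b) (k : ℕ) (x : ℝ) :
    Measurable (convCDF t τ X n b k x) := by
  have ha : ∀ i, 1 ≤ i → Measurable (analog t τ X n b i) :=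
    fun i hi => measurable_analog hX ht hn hb hi
  have hmean : Measurable (subMean t τ X n b) :=
    (Finset.measurable_fun_sum _ fun i hi => ha i (Finset.mem_Icc.mp hi).1).const_mul _
  have hS : MeasurableSet {p : Ω × (Fin k → ℕ) | (Real.sqrt k)⁻¹ *
      ∑ j, (analog t τ X n b (max (p.2 j) 1) p.1 - subMean t τ X n b p.1) ≤ x} := by
    -- There are countably many index tuples, so it suffices to check measurability in `ω` with the
    -- tuple fixed.
    refine measurableSet_le (measurable_from_prod_countable_left fun f => ?_) measurable_const
    exact (Finset.measurable_fun_sum _ fun j _ =>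
      (ha _ (le_max_right _ _)).sub hmean).const_mul _
  have := (measurable_measure_prodMk_left
    (ν := Measure.pi fun _ : Fin k => indexLaw (numBlocks n b)) hS).ennreal_toReal
  convert this using 2 with ω
  exact convCDF_eq_indexLaw t τ X n b ω k x

end Measurability

/-! ### Negligible tails under each of the four conditions. -/

section Tails

variable {t : (m : ℕ) → (Fin m → ℝ) → ℝ} {τ : ℕ → ℝ} {X : ℕ → Ω → ℝ}

theorem truncVar_subLaw_le {c : ℝ} (hc : 0 ≤ c) (a : ℝ) (n b : ℕ) (ω : Ω) :
    truncVar (subLaw t τ X n b ω) (4 * c) ≤ 16 * ((numBlocks n b : ℝ)⁻¹ *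
      ∑ i ∈ Finset.Icc 1 (numBlocks n b), sqExcess c (analog t τ X n b i ω - a)) := by
  rw [← integral_subLaw t τ X n b ω fun y => sqExcess c (y - a)]
  exact truncVar_le_integral_sqExcess (memLp_subLaw t τ X n b ω) hc a

theorem sqExcess_le_rpow {c ε : ℝ} (hc : 0 < c) (hε : 0 < ε) (y : ℝ) :
    sqExcess c y ≤ c ^ (-ε) * |y| ^ (2 + ε) := by
  rcases le_total |y| c with h | h
  · rw [sqExcess_eq_zero h]; positivity
  · refine (sqExcess_le_sq hc.le y).trans ?_
    have hy : 0 < |y| := hc.trans_le h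
    rw [Real.rpow_add hy, Real.rpow_two, sq_abs, Real.rpow_neg hc.le]
    have h1 : c ^ ε ≤ |y| ^ ε := Real.rpow_le_rpow hc.le h hε.le
    have h2 : 0 < c ^ ε := Real.rpow_pos_of_pos hc _
    rw [inv_mul_eq_div, le_div_iff₀ h2]
    gcongr

/-- The shift does not depend on `i`, so a common change of centre replaces the estimator `t_n` by
the parameter. -/
theorem analog_sub_eq_scaledError (θ : ℝ) (n b i : ℕ) (ω : Ω) :
    analog t τ X n b i ω - τ b * (θ - stat t X 1 n ω) = scaledError t τ θ X i b ω := by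
  unfold analog scaledError
  ring

theorem sqExcess_sqrt_le_indicator (C : NNReal) (u : ℝ) :
    sqExcess (Real.sqrt C) u ≤ ‖{y : ℝ | C ≤ ‖y ^ 2‖₊}.indicator (fun y => y ^ 2) u‖ := by
  by_cases h : C ≤ ‖u ^ 2‖₊
  · rw [Set.indicator_of_mem (by exact h), Real.norm_eq_abs, abs_of_nonneg (sq_nonneg u)]
    exact sqExcess_le_sq (Real.sqrt_nonneg _) u
  · rw [sqExcess_eq_zero]
    · exact norm_nonneg _
    · refine Real.abs_le_sqrt ?_
      have h1 : ((‖u ^ 2‖₊ : NNReal) : ℝ) ≤ C := NNReal.coe_le_coe.mpr (not_le.mp h).le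
      rwa [coe_nnnorm, Real.norm_eq_abs, abs_of_nonneg (sq_nonneg u)] at h1

variable [MeasurableSpace Ω] {P : Measure Ω} {b : ℕ → ℕ}

theorem tailsNegligible_of_isBigOInProb_rpow {ε : ℝ} (hε : 0 < ε)
    (h : IsBigOInProb P (fun n ω => (numBlocks n (b n) : ℝ)⁻¹ *
      ∑ i ∈ Finset.Icc 1 (numBlocks n (b n)), |analog t τ X n (b n) i ω| ^ (2 + ε))
      (fun _ => 1)) :
    TailsNegligible P fun n => subLaw t τ X n (b n) := by
  intro δ hδ η hη
  obtain ⟨M, hM⟩ := h η hη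
  have hlim : Tendsto (fun c : ℝ => 16 * (c ^ (-ε) * M)) atTop (𝓝 (16 * (0 * M))) :=
    ((tendsto_rpow_neg_atTop hε).mul_const M).const_mul 16
  rw [zero_mul, mul_zero] at hlim
  obtain ⟨c, hcδ, hc⟩ := ((hlim.eventually_le_const hδ).and (eventually_gt_atTop 0)).exists
  refine ⟨4 * c, hM.mono fun n hn => (measure_mono fun ω hω => ?_).trans hn⟩
  by_contra hcon
  simp only [Set.mem_ofPred_eq, not_lt, abs_one, mul_one] at hcon hω
  have h1 := truncVar_subLaw_le (t := t) (τ := τ) (X := X) hc.le 0 n (b n) ω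
  have hN : (0 : ℝ) ≤ (numBlocks n (b n) : ℝ)⁻¹ := by positivity
  have h2 : (numBlocks n (b n) : ℝ)⁻¹ * ∑ i ∈ Finset.Icc 1 (numBlocks n (b n)),
      sqExcess c (analog t τ X n (b n) i ω - 0)
      ≤ c ^ (-ε) * ((numBlocks n (b n) : ℝ)⁻¹ *
        ∑ i ∈ Finset.Icc 1 (numBlocks n (b n)), |analog t τ X n (b n) i ω| ^ (2 + ε)) := by
    rw [mul_left_comm, Finset.mul_sum _ _ (c ^ (-ε))]
    refine mul_le_mul_of_nonneg_left (Finset.sum_le_sum fun i _ => ?_) hN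
    rw [sub_zero]
    exact sqExcess_le_rpow hc hε _
  have h3 := (le_abs_self _).trans hcon
  have h4 := mul_le_mul_of_nonneg_left h3 (Real.rpow_nonneg hc.le (-ε))
  linarith

theorem tailsNegligible_of_tendstoInMeasure_subCDF {J : Measure ℝ} [IsProbabilityMeasure J]
    (hJ : MemLp id 2 J)
    (hcdf : ∀ x : ℝ, ContinuousAt (cdf J) x →
      TendstoInMeasure P (fun n => subCDF t τ X n (b n) x) atTop (fun _ => cdf J x))
    (hvar : TendstoInMeasure P (fun n => subVar t τ X n (b n)) atTop (fun _ => variance id J)) :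
    TailsNegligible P fun n => subLaw t τ X n (b n) := by
  intro δ hδ η hη
  obtain ⟨c, s, hs, ρ, hρ, hclose⟩ := exists_truncVar_le_of_cdf_close hJ hδ
  have hlim : Tendsto (fun n => ∑ x ∈ s, P {ω | ρ ≤ ‖subCDF t τ X n (b n) x ω - cdf J x‖}
      + P {ω | ρ ≤ ‖subVar t τ X n (b n) ω - variance id J‖}) atTop
      (𝓝 (∑ x ∈ s, 0 + 0)) :=
    (tendsto_finsetSum s fun x hx => tendstoInMeasure_iff_norm.mp (hcdf x (hs x hx)) ρ hρ).add
      (tendstoInMeasure_iff_norm.mp hvar ρ hρ)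
  rw [Finset.sum_const_zero, add_zero] at hlim
  refine ⟨c, (ENNReal.tendsto_nhds_zero.mp hlim η hη).mono fun n hn => le_trans ?_ hn⟩
  refine le_trans (measure_mono (t := (⋃ x ∈ s, {ω | ρ ≤ ‖subCDF t τ X n (b n) x ω - cdf J x‖}) ∪
    {ω | ρ ≤ ‖subVar t τ X n (b n) ω - variance id J‖}) fun ω hω => ?_)
    ((measure_union_le _ _).trans (add_le_add (measure_biUnion_finset_le s _) le_rfl))
  by_contra hcon
  simp only [Set.mem_union, Set.mem_iUnion, Set.mem_ofPred_eq, not_or, not_exists, not_le]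
    at hcon hω
  refine absurd (hclose _ (memLp_subLaw t τ X n (b n) ω) (fun x hx => ?_) ?_) (not_le.mpr hω)
  · rw [cdf_subLaw]; exact hcon.1 x hx
  · rw [variance_subLaw]; exact hcon.2

/-- Centre at the parameter and apply Markov's inequality to the average excess. The expectation of
an average needs no control of the dependence between blocks. -/
theorem tailsNegligible_of_uniform_tails {θ : ℝ} (hX : ∀ i, 1 ≤ i → Measurable (X i))
    (ht : ∀ m, 1 ≤ m → Measurable (t m)) (hb : ∀ n, 2 ≤ n → 1 ≤ b n ∧ b n < n)
    (h : ∀ ε : ℝ, 0 < ε → ∃ C : NNReal, ∀ n, 2 ≤ n →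
      ∀ i ∈ Finset.Icc 1 (numBlocks n (b n)),
        eLpNorm ({y : ℝ | C ≤ ‖y ^ 2‖₊}.indicator (fun y => y ^ 2) ∘
          scaledError t τ θ X i (b n)) 1 P ≤ ENNReal.ofReal ε) :
    TailsNegligible P fun n => subLaw t τ X n (b n) := by
  intro δ hδ η hη
  obtain ⟨r, hr0, hrη⟩ : ∃ r : ℝ, 0 < r ∧ ENNReal.ofReal r ≤ η := by
    have h1 : min η 1 ≠ ⊤ := ne_top_of_le_ne_top ENNReal.one_ne_top (min_le_right _ _)
    refine ⟨(min η 1).toReal, ENNReal.toReal_pos (lt_min hη one_pos).ne' h1, ?_⟩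
    rw [ENNReal.ofReal_toReal h1]
    exact min_le_left _ _
  -- The factor `16` of `truncVar_subLaw_le` and the division by `δ` in Markov's inequality turn
  -- this into exactly `r`.
  obtain ⟨C, hC⟩ := h (δ * r / 16) (by positivity)
  set c := Real.sqrt C with hc
  refine ⟨4 * c, (eventually_ge_atTop 2).mono fun n hn => ?_⟩
  set N := numBlocks n (b n) with hNdef
  have hN : (0 : ℝ) < N := by rw [hNdef, numBlocks]; positivity
  have hmeas : ∀ i ∈ Finset.Icc 1 N,
      Measurable fun ω => ENNReal.ofReal (sqExcess c (scaledError t τ θ X i (b n) ω)) :=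
    fun i hi => ((continuous_sqExcess c).measurable.comp (measurable_scaledError hX ht
      (hb n hn).1 (Finset.mem_Icc.mp hi).1)).ennreal_ofReal
  have hint : ∫⁻ ω, ∑ i ∈ Finset.Icc 1 N,
      ENNReal.ofReal (sqExcess c (scaledError t τ θ X i (b n) ω)) ∂P
      ≤ N * ENNReal.ofReal (δ * r / 16) := by
    rw [lintegral_finsetSum _ hmeas]
    refine (Finset.sum_le_card_nsmul _ _ (ENNReal.ofReal (δ * r / 16)) fun i hi => ?_).trans
      (by simp)
    refine le_trans ?_ (hC n hn i hi)
    rw [eLpNorm_one_eq_lintegral_enorm]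
    refine lintegral_mono fun ω => ?_
    rw [← ofReal_norm]
    exact ENNReal.ofReal_le_ofReal (sqExcess_sqrt_le_indicator C _)
  have hsub : {ω | δ < truncVar (subLaw t τ X n (b n) ω) (4 * c)} ⊆
      {ω | ENNReal.ofReal (δ * N / 16) ≤ ∑ i ∈ Finset.Icc 1 N,
        ENNReal.ofReal (sqExcess c (scaledError t τ θ X i (b n) ω))} := by
    intro ω hω
    have h1 := truncVar_subLaw_le (t := t) (τ := τ) (X := X) (Real.sqrt_nonneg C)
      (τ (b n) * (θ - stat t X 1 n ω)) n (b n) ω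
    simp_rw [analog_sub_eq_scaledError] at h1
    have h2 := (show δ < _ from hω).trans_le h1
    rw [Set.mem_ofPred_eq, ← ENNReal.ofReal_sum_of_nonneg fun _ _ => sqExcess_nonneg _ _]
    refine ENNReal.ofReal_le_ofReal ?_
    rw [← hNdef, ← hc, ← mul_assoc, mul_comm, ← mul_assoc, ← div_eq_mul_inv,
      lt_div_iff₀ hN] at h2
    linarith
  have hpos : ENNReal.ofReal (δ * N / 16) ≠ 0 := (ENNReal.ofReal_pos.mpr (by positivity)).ne'
  refine (measure_mono hsub).trans ((meas_ge_le_lintegral_div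
    (Finset.measurable_fun_sum _ hmeas).aemeasurable hpos ENNReal.ofReal_ne_top).trans ?_)
  refine (ENNReal.div_le_div_right hint _).trans (le_trans (le_of_eq ?_) hrη)
  rw [← ENNReal.ofReal_natCast, ← ENNReal.ofReal_mul hN.le,
    ← ENNReal.ofReal_div_of_pos (by positivity)]
  congr 1
  field_simp

theorem IsStationary.identDistrib_scaledError (hstat : IsStationary P X)
    (ht : ∀ m, 1 ≤ m → Measurable (t m)) (θ : ℝ) {i m : ℕ} (hi : 1 ≤ i) (hm : 1 ≤ m) :
    IdentDistrib (scaledError t τ θ X i m) (scaledError t τ θ X 1 m) P P := by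
  have h := hstat m (fun j => 1 + j) (fun j => Nat.le_add_right _ _) (i - 1)
  have e : (fun ω (j : Fin m) => X (1 + j + (i - 1)) ω) = fun ω => block X i m ω := by
    funext ω j
    have : 1 + (j : ℕ) + (i - 1) = i + j := by omega
    rw [this, block]
  rw [e] at h
  exact h.comp (u := fun y => τ m * (t m y - θ)) (((ht m hm).sub_const θ).const_mul _)

end Tails

end Subsampling

/-! ### The equivalence. -/

theorem corollary1 {Ω : Type*} [MeasurableSpace Ω] (P : Measure Ω) [IsProbabilityMeasure P]
    -- the real-valued process `X_1, X_2, …`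
    (X : ℕ → Ω → ℝ) (hX : ∀ i, 1 ≤ i → Measurable (X i))
    -- the statistics `t_n`, the parameter `θ = t(P)` and the scaling factors `τ_n`
    (t : (m : ℕ) → (Fin m → ℝ) → ℝ) (ht : ∀ m, 1 ≤ m → Measurable (t m))
    (θ : ℝ) (τ : ℕ → ℝ) (hτ : ∀ n, 1 ≤ n → 0 < τ n)
    -- the block lengths `1 ≤ b_n < n` (there is none for `n ≤ 1`)
    (b : ℕ → ℕ) (hb : ∀ n, 2 ≤ n → 1 ≤ b n ∧ b n < n)
    (σ : ℝ) (hσ : 0 < σ)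
    (hC :
      -- the subsampling distribution converges weakly to a law with variance `σ ^ 2`
      (∃ J : Measure ℝ, IsProbabilityMeasure J ∧ MemLp id 2 J ∧ variance id J = σ ^ 2 ∧
        ∀ x : ℝ, ContinuousAt (cdf J) x →
          TendstoInMeasure P (fun n => Subsampling.subCDF t τ X n (b n) x) atTop
            (fun _ => cdf J x)) ∨
      -- a subsample moment of order larger than two is stochastically bounded
      (∃ ε₀ : ℝ, 0 < ε₀ ∧
        Subsampling.IsBigOInProb P
          (fun n ω => (Subsampling.numBlocks n (b n) : ℝ)⁻¹ *
            ∑ i ∈ Finset.Icc 1 (Subsampling.numBlocks n (b n)),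
              |Subsampling.analog t τ X n (b n) i ω| ^ (2 + ε₀))
          (fun _ => 1)) ∨
      -- the `T_{b,i} ^ 2` are uniformly integrable and `T_n = O_p(τ_n / τ_b)`
      (UniformIntegrable
          (fun (p : {p : ℕ × ℕ // 2 ≤ p.1 ∧ 1 ≤ p.2 ∧
              p.2 ≤ Subsampling.numBlocks p.1 (b p.1)}) ω =>
            (Subsampling.scaledError t τ θ X p.1.2 (b p.1.1) ω) ^ 2) 1 P ∧
        Subsampling.IsBigOInProb P (fun n => Subsampling.scaledError t τ θ X 1 n)
          (fun n => τ n / τ (b n))) ∨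
      -- stationarity, uniform integrability of the `T_n ^ 2`, and `τ_b / τ_n = O(1)`
      (Subsampling.IsStationary P X ∧
        UniformIntegrable
          (fun (n : {n : ℕ // 1 ≤ n}) ω => (Subsampling.scaledError t τ θ X 1 n ω) ^ 2) 1 P ∧
        (fun n => τ (b n) / τ n) =O[atTop] (fun _ => (1 : ℝ)))) :
    (∀ k : ℕ → ℕ, (∀ n, 1 ≤ k n) → Tendsto k atTop atTop →
      TendstoInMeasure P
        (fun n ω => ⨆ x : ℝ, |Subsampling.convCDF t τ X n (b n) (k n) x ω
          - Subsampling.stdNormalCDF (x / σ)|) atTop (fun _ => 0)) ↔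
    TendstoInMeasure P (fun n => Subsampling.subVar t τ X n (b n)) atTop (fun _ => σ ^ 2) := by
  constructor
  · intro h
    have := Subsampling.tendstoInMeasure_variance_of_forall_iSup (P := P)
      (ν := fun n => Subsampling.subLaw t τ X n (b n))
      (fun n ω => Subsampling.memLp_subLaw t τ X n (b n) ω) (n₀ := 2)
      (fun n hn k => by
        simp_rw [Subsampling.cdf_sumLaw_subLaw]
        exact Subsampling.measurable_convCDF hX ht (by omega) (hb n hn).1 k 1) hσ
      (fun k hk1 hk => by
        simp_rw [Subsampling.cdf_sumLaw_subLaw]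
        exact h k hk1 hk)
    simpa only [Subsampling.variance_subLaw] using this
  · intro hvar k _ hk
    have htail : Subsampling.TailsNegligible P fun n => Subsampling.subLaw t τ X n (b n) := by
      rcases hC with ⟨J, hJp, hJ, hJσ, hcdf⟩ | ⟨ε, hε, h⟩ | ⟨h, -⟩ | ⟨hstat, h, -⟩
      · exact Subsampling.tailsNegligible_of_tendstoInMeasure_subCDF hJ hcdf (by rwa [hJσ])
      · exact Subsampling.tailsNegligible_of_isBigOInProb_rpow hε h
      · refine Subsampling.tailsNegligible_of_uniform_tails (θ := θ) hX ht hb fun ε hε => ?_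
        obtain ⟨C, hC⟩ := h.spec one_ne_zero ENNReal.one_ne_top hε
        refine ⟨C, fun n hn i hi => ?_⟩
        obtain ⟨hi1, hi2⟩ := Finset.mem_Icc.mp hi
        exact hC ⟨(n, i), hn, hi1, hi2⟩
      · refine Subsampling.tailsNegligible_of_uniform_tails (θ := θ) hX ht hb fun ε hε => ?_
        obtain ⟨C, hC⟩ := h.spec one_ne_zero ENNReal.one_ne_top hε
        refine ⟨C, fun n hn i hi => ?_⟩
        -- By stationarity every block statistic has the law of the first one, which is the member
        -- of index `b n` of the family `T_m`.
        have hid := hstat.identDistrib_scaledError (τ := τ) ht θ (Finset.mem_Icc.mp hi).1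
          (hb n hn).1
        have hψ : Measurable ({y : ℝ | C ≤ ‖y ^ 2‖₊}.indicator fun y => y ^ 2) :=
          (measurable_id.pow_const 2).indicator (measurableSet_le (by fun_prop) (by fun_prop))
        rw [(hid.comp hψ).eLpNorm_eq]
        exact hC ⟨b n, (hb n hn).1⟩
    have := Subsampling.tendstoInMeasure_iSup_cdf_sumLaw
      (fun n ω => Subsampling.memLp_subLaw t τ X n (b n) ω) htail hσ
      (by simpa only [Subsampling.variance_subLaw] using hvar) hk
    simp_rw [Subsampling.cdf_sumLaw_subLaw] at this
    exact this
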